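/- **Gaussian Isoperimetric Inequality.** Let $\gamma_d$ be the standard Gaussian measure on $\mathbb{R}^d$, and let $\varphi$ and $\Phi$ be the density and the cumulative distribution function of the standard Gaussian distribution on $\mathbb{R}$. For a ($\gamma_d$-measurable) set $A \subseteq \mathbb{R}^d$ and $0 \le \theta \le \frac{\pi}{2}$, let the rotation sensitivity of $A$ be $$\mathrm{RS}_A(\theta) = \Pr[1_A(z) \ne 1_A(z')], \qquad z' = (\cos\theta)\, z + (\sin\theta)\, g,$$ where $z, g$ are independent standard $d$-dimensional Gaussian vectors; thus $\mathrm{RS}_A(0) = 0$. The Gaussian surface area of $A$ is $$\mathrm{surf}_d(A) = \sqrt{\tfrac{\pi}{2}}\cdot \mathrm{RS}_A'(0^+), \qquad \mathrm{RS}_A'(0^+) = \lim_{\delta\to 0^+} \frac{\mathrm{RS}_A(\delta)}{\delta} \in [0,\infty].$$ Let $A \subseteq \mathbb{R}^d$ be any ($\gamma_d$-measurable) set, with Gaussian volume $\gamma_d(A) = \alpha$. Then the limit defining $\mathrm{RS}_A'(0^+)$ exists in $[0,\infty]$, and $$\mathrm{surf}_d(A) \ \ge\ \varphi(\Phi^{-1}(\alpha)),$$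 where $\varphi(\Phi^{-1}(\alpha))$ is read as $0$ for $\alpha \in \{0,1\}$. Moreover, for every halfspace $H \subseteq \mathbb{R}^d$ with $\gamma_d(H) = \alpha$, $$\mathrm{surf}_d(A) \ \ge\ \mathrm{surf}_d(H) = \varphi(\Phi^{-1}(\alpha)).$$ Here a halfspace is a set $\{x : \langle v, x\rangle \le t\}$ or $\{x : \langle v, x\rangle < t\}$ with $v \in \mathbb{R}^d \setminus \{0\}$ and $t \in [-\infty, \infty]$. -/

import Mathlib

open MeasureTheory ProbabilityTheory Filter Topology
open scoped ENNReal

noncomputable section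

/-- The standard Gaussian measure on `ℝ^d`. -/
abbrev gaussMeasure (d : ℕ) : Measure (EuclideanSpace ℝ (Fin d)) :=
  stdGaussian (EuclideanSpace ℝ (Fin d))

/-- The law of a `ρ`-correlated `d`-dimensional Gaussian pair `(z, z')`: `z` is a standard Gaussian
vector and `z' = ρ z + √(1 - ρ²) g`, with `g` a standard Gaussian vector independent of `z`. -/
def corrGaussPair (d : ℕ) (ρ : ℝ) :
    Measure (EuclideanSpace ℝ (Fin d) × EuclideanSpace ℝ (Fin d)) :=
  ((gaussMeasure d).prod (gaussMeasure d)).map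
    (fun p => (p.1, ρ • p.1 + √(1 - ρ ^ 2) • p.2))

/-- Rotation sensitivity: the probability that exactly one of `z`, `z'` lies in `A`, where `(z, z')`
is a `cos θ`-correlated Gaussian pair. -/
def rotSens {d : ℕ} (A : Set (EuclideanSpace ℝ (Fin d))) (θ : ℝ) : ℝ≥0∞ :=
  corrGaussPair d (Real.cos θ) {p | ¬ (p.1 ∈ A ↔ p.2 ∈ A)}

/-- The rotation sensitivity vanishes at angle `0`, so that its difference quotient at `0` is
`rotSens A δ / δ`. -/
theorem rotSens_zero {d : ℕ} (A : Set (EuclideanSpace ℝ (Fin d))) : rotSens A 0 = 0 := by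
  have hm : Measurable (fun p : EuclideanSpace ℝ (Fin d) × EuclideanSpace ℝ (Fin d) =>
      (p.1, p.1)) := by fun_prop
  have hD : MeasurableSet {p : EuclideanSpace ℝ (Fin d) × EuclideanSpace ℝ (Fin d) |
      p.1 ≠ p.2} := (measurableSet_eq_fun measurable_fst measurable_snd).compl
  unfold rotSens corrGaussPair
  refine measure_mono_null (t := {p | p.1 ≠ p.2}) ?_ ?_
  · intro p hp h
    exact hp (by rw [h])
  · simp only [Real.cos_zero, one_smul, one_pow, sub_self, Real.sqrt_zero, zero_smul, add_zero]
    rw [Measure.map_apply hm hD]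
    simp

/-- The difference quotient at `0` of the rotation sensitivity. -/
def rotSensQuot {d : ℕ} (A : Set (EuclideanSpace ℝ (Fin d))) (δ : ℝ) : ℝ≥0∞ :=
  rotSens A δ / ENNReal.ofReal δ

/-- The right derivative at `0` of the rotation sensitivity, with values in `[0, ∞]`. -/
def rotSensDeriv {d : ℕ} (A : Set (EuclideanSpace ℝ (Fin d))) : ℝ≥0∞ :=
  limUnder (𝓝[>] (0 : ℝ)) (rotSensQuot A)

/-- Gaussian surface area. -/
def gaussSurf {d : ℕ} (A : Set (EuclideanSpace ℝ (Fin d))) : ℝ≥0∞ :=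
  ENNReal.ofReal √(Real.pi / 2) * rotSensDeriv A

/-- Closed and open halfspaces. The thresholds `t = ⊥` and `t = ⊤` give the degenerate halfspaces
(the empty set and the whole space), of Gaussian volume `0` and `1`. -/
def IsHalfspace {d : ℕ} (H : Set (EuclideanSpace ℝ (Fin d))) : Prop :=
  ∃ (v : EuclideanSpace ℝ (Fin d)) (t : EReal), v ≠ 0 ∧
    (H = {x | ((inner ℝ v x : ℝ) : EReal) ≤ t} ∨ H = {x | ((inner ℝ v x : ℝ) : EReal) < t})

/-- The standard Gaussian cdf `Φ`. -/
def gaussCdf (t : ℝ) : ℝ := cdf (gaussianReal 0 1) t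

open Classical in
/-- The Gaussian isoperimetric function `φ ∘ Φ⁻¹` on `[0, 1]`, with value `0` at the end points
`0` and `1` (where `Φ⁻¹ = ∓∞`); `φ` is the standard Gaussian density. -/
def gaussIso (α : ℝ) : ℝ :=
  if 0 < α ∧ α < 1 then gaussianPDFReal 0 1 (Function.invFun gaussCdf α) else 0

end

/-! ### The standard Gaussian cdf and the isoperimetric function -/

/-! Write I for `gaussIso`, that is φ∘Φ⁻¹. The lower bound rests on Bobkov's functional inequality
I(E F) ≤ E √(I(F)² + |∇F|²) for F : ℝ^d → [0,1] under the Gaussian measure. For F = 1_A the term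
I(F) vanishes and the right side is formally E|∇F|, the surface area of A. Rotation sensitivity sees
this quantity through E|⟨∇F(z), g⟩| = √(2/π) E|∇F|, whence the normalization √(π/2).

Bobkov's inequality: since (I²)'' = 2(Φ⁻¹)² - 2, convexity arguments give a two-point inequality
(`gaussIso_two_point`). It tensorizes to the discrete cube (`bobkov_cube`), and the central limit
theorem for sign sums carries it to Gauss space (`bobkov_gaussMeasure`).

Existence of the limit: a Gaussian pair is rotation invariant, so the sensitivity is subadditive in
the angle (`noiseSens_add_le`), and it tends to 0 at angle 0. By Fekete's lemma the difference
quotient converges to its supremum L, so the sensitivity is at most L θ for every θ > 0, not only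
asymptotically.

Passage to sets: 1_A is replaced by F = `noiseOp s` 1_A. It has the same mean, is differentiable by
the Cameron–Martin formula (`hasUniformGradient_noiseOp`), and is no more noise sensitive than 1_A
(`noiseSens_noiseOp_le`), so Fatou's lemma gives √(2/π) E|∇F| ≤ L. From I(p)² ≤ p(1 - p) follows E
I(F) ≤ √(`noiseSens` 1_A s), which tends to 0 with s. Hence I(α) ≤ √(π/2) L.

For a halfspace everything depends on one Gaussian coordinate, and dominated convergence evaluates
the derivative as φ(τ) E|y| = φ(τ) √(2/π), with τ the normalized threshold. -/

theorem gaussianPDFReal_zero_one (x : ℝ) :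
    gaussianPDFReal 0 1 x = (√(2 * Real.pi))⁻¹ * Real.exp (-x ^ 2 / 2) := by
  simp [gaussianPDFReal]

theorem hasDerivAt_gaussianPDFReal (x : ℝ) :
    HasDerivAt (gaussianPDFReal 0 1) (-x * gaussianPDFReal 0 1 x) x := by
  have h : gaussianPDFReal 0 1 = fun x => (√(2 * Real.pi))⁻¹ * Real.exp (-x ^ 2 / 2) := by
    ext x; exact gaussianPDFReal_zero_one x
  rw [h]
  have := ((((hasDerivAt_id x).pow 2).neg.div_const 2).exp).const_mul (√(2 * Real.pi))⁻¹
  refine HasDerivAt.congr_deriv this ?_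
  simp
  ring

theorem continuous_gaussianPDFReal : Continuous (gaussianPDFReal 0 1) :=
  continuous_iff_continuousAt.2 fun x => (hasDerivAt_gaussianPDFReal x).continuousAt

theorem gaussianPDFReal_zero_one_pos (x : ℝ) : 0 < gaussianPDFReal 0 1 x :=
  gaussianPDFReal_pos 0 1 x one_ne_zero

theorem gaussianPDFReal_le_of_abs_le {x y : ℝ} (h : |x| ≤ |y|) :
    gaussianPDFReal 0 1 y ≤ gaussianPDFReal 0 1 x := by
  rw [gaussianPDFReal_zero_one, gaussianPDFReal_zero_one]
  have := sq_le_sq.2 h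
  gcongr

theorem gaussianPDFReal_neg (x : ℝ) : gaussianPDFReal 0 1 (-x) = gaussianPDFReal 0 1 x := by
  simp [gaussianPDFReal_zero_one]

theorem gaussianPDFReal_le_one (x : ℝ) : gaussianPDFReal 0 1 x ≤ 1 := by
  rw [gaussianPDFReal_zero_one]
  have h1 : Real.exp (-x ^ 2 / 2) ≤ 1 := Real.exp_le_one_iff.2 (by nlinarith [sq_nonneg x])
  have h2 : (√(2 * Real.pi))⁻¹ ≤ 1 := by
    apply inv_le_one_of_one_le₀
    rw [Real.one_le_sqrt]
    nlinarith [Real.pi_gt_three]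
  have := Real.exp_nonneg (-x ^ 2 / 2)
  have h3 : 0 ≤ (√(2 * Real.pi))⁻¹ := by positivity
  nlinarith

theorem tendsto_gaussianPDFReal_atBot : Tendsto (gaussianPDFReal 0 1) atBot (𝓝 0) := by
  have h : gaussianPDFReal 0 1 = fun x => (√(2 * Real.pi))⁻¹ * Real.exp (-(x ^ 2 / 2)) := by
    ext x; rw [gaussianPDFReal_zero_one, neg_div]
  rw [h]
  have h2 : Tendsto (fun x : ℝ => x ^ 2 / 2) atBot atTop := by
    have := (tendsto_pow_atTop (two_ne_zero (α := ℕ))).comp (tendsto_neg_atBot_atTop (G := ℝ))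
    refine (this.congr fun x => ?_).atTop_div_const two_pos
    simp
  simpa using (Real.tendsto_exp_neg_atTop_nhds_zero.comp h2).const_mul (√(2 * Real.pi))⁻¹

theorem gaussCdf_eq (t : ℝ) : gaussCdf t = ∫ x in Set.Iic t, gaussianPDFReal 0 1 x := by
  rw [gaussCdf, cdf_eq_real, Measure.real, gaussianReal_apply_eq_integral 0 one_ne_zero,
    ENNReal.toReal_ofReal (integral_nonneg fun x => gaussianPDFReal_nonneg 0 1 x)]

theorem hasDerivAt_gaussCdf (t : ℝ) : HasDerivAt gaussCdf (gaussianPDFReal 0 1 t) t := by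
  have hi : ∀ a, IntegrableOn (gaussianPDFReal 0 1) (Set.Iic a) := fun a =>
    (integrable_gaussianPDFReal 0 1).integrableOn
  have h : gaussCdf = fun t => gaussCdf 0 + ∫ x in (0 : ℝ)..t, gaussianPDFReal 0 1 x := by
    ext t
    rw [gaussCdf_eq, gaussCdf_eq, ← intervalIntegral.integral_Iic_sub_Iic (hi _) (hi _)]
    ring
  rw [h]
  exact (intervalIntegral.integral_hasDerivAt_right
    (integrable_gaussianPDFReal 0 1).intervalIntegrable
    (stronglyMeasurable_gaussianPDFReal 0 1).stronglyMeasurableAtFilter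
    continuous_gaussianPDFReal.continuousAt).const_add _

theorem continuous_gaussCdf : Continuous gaussCdf :=
  continuous_iff_continuousAt.2 fun x => (hasDerivAt_gaussCdf x).continuousAt

theorem strictMono_gaussCdf : StrictMono gaussCdf :=
  strictMono_of_hasDerivAt_pos hasDerivAt_gaussCdf gaussianPDFReal_zero_one_pos

theorem gaussCdf_pos (t : ℝ) : 0 < gaussCdf t :=
  (cdf_nonneg _ (t - 1)).trans_lt (strictMono_gaussCdf (by linarith))

theorem gaussCdf_lt_one (t : ℝ) : gaussCdf t < 1 :=
  (strictMono_gaussCdf (by linarith : t < t + 1)).trans_le (cdf_le_one _ _)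

/-- The density is even, so `gaussCdf (-t) + gaussCdf t` has derivative zero; its limit at infinity
is 1. -/
theorem gaussCdf_neg (t : ℝ) : gaussCdf (-t) = 1 - gaussCdf t := by
  have hd : ∀ t, HasDerivAt (fun t => gaussCdf (-t) + gaussCdf t) 0 t := by
    intro t
    have h1 := (hasDerivAt_gaussCdf (-t)).comp t (hasDerivAt_neg t)
    refine HasDerivAt.congr_deriv (h1.add (hasDerivAt_gaussCdf t)) ?_
    rw [gaussianPDFReal_neg]; ring
  have hc : ∀ t, gaussCdf (-t) + gaussCdf t = gaussCdf (-0) + gaussCdf 0 := fun t =>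
    is_const_of_deriv_eq_zero (fun t => (hd t).differentiableAt) (fun t => (hd t).deriv) t 0
  have hl : Tendsto (fun t => gaussCdf (-t) + gaussCdf t) atTop (𝓝 (0 + 1)) :=
    ((tendsto_cdf_atBot _).comp tendsto_neg_atTop_atBot).add (tendsto_cdf_atTop _)
  have hl' : Tendsto (fun t => gaussCdf (-t) + gaussCdf t) atTop
      (𝓝 (gaussCdf (-0) + gaussCdf 0)) := by
    simp_rw [hc]; exact tendsto_const_nhds
  have := tendsto_nhds_unique hl hl'
  linarith [hc t]

/-- The Gaussian quantile function, the inverse of `gaussCdf` on `(0, 1)`. -/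
noncomputable def gaussQuantile (p : ℝ) : ℝ := Function.invFun gaussCdf p

theorem gaussQuantile_gaussCdf (t : ℝ) : gaussQuantile (gaussCdf t) = t :=
  Function.leftInverse_invFun strictMono_gaussCdf.injective t

theorem gaussCdf_gaussQuantile {p : ℝ} (hp : p ∈ Set.Ioo (0 : ℝ) 1) :
    gaussCdf (gaussQuantile p) = p := by
  apply Function.invFun_eq
  obtain ⟨a, ha⟩ := ((tendsto_cdf_atBot (gaussianReal 0 1)).eventually_lt_const hp.1).exists
  obtain ⟨b, hb⟩ := ((tendsto_cdf_atTop (gaussianReal 0 1)).eventually_const_lt hp.2).exists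
  exact mem_range_of_exists_le_of_exists_ge continuous_gaussCdf ⟨a, ha.le⟩ ⟨b, hb.le⟩

theorem strictMonoOn_gaussQuantile : StrictMonoOn gaussQuantile (Set.Ioo 0 1) := by
  intro p hp r hr hpr
  rwa [← strictMono_gaussCdf.lt_iff_lt, gaussCdf_gaussQuantile hp, gaussCdf_gaussQuantile hr]

theorem gaussQuantile_one_sub {p : ℝ} (hp : p ∈ Set.Ioo (0 : ℝ) 1) :
    gaussQuantile (1 - p) = -gaussQuantile p := by
  apply strictMono_gaussCdf.injective
  rw [gaussCdf_neg, gaussCdf_gaussQuantile hp, gaussCdf_gaussQuantile]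
  exact ⟨by linarith [hp.2], by linarith [hp.1]⟩

theorem gaussIso_of_mem {p : ℝ} (hp : p ∈ Set.Ioo (0 : ℝ) 1) :
    gaussIso p = gaussianPDFReal 0 1 (gaussQuantile p) := if_pos hp

theorem gaussIso_of_notMem {p : ℝ} (hp : p ∉ Set.Ioo (0 : ℝ) 1) : gaussIso p = 0 := if_neg hp

theorem gaussIso_gaussCdf (t : ℝ) : gaussIso (gaussCdf t) = gaussianPDFReal 0 1 t := by
  rw [gaussIso_of_mem ⟨gaussCdf_pos t, gaussCdf_lt_one t⟩, gaussQuantile_gaussCdf]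

theorem gaussIso_pos {p : ℝ} (hp : p ∈ Set.Ioo (0 : ℝ) 1) : 0 < gaussIso p := by
  rw [gaussIso_of_mem hp]; exact gaussianPDFReal_zero_one_pos _

theorem gaussIso_nonneg (p : ℝ) : 0 ≤ gaussIso p := by
  by_cases hp : p ∈ Set.Ioo (0 : ℝ) 1
  · exact (gaussIso_pos hp).le
  · rw [gaussIso_of_notMem hp]

theorem gaussIso_le_one (p : ℝ) : gaussIso p ≤ 1 := by
  by_cases hp : p ∈ Set.Ioo (0 : ℝ) 1
  · rw [gaussIso_of_mem hp]; exact gaussianPDFReal_le_one _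
  · rw [gaussIso_of_notMem hp]; exact zero_le_one

theorem gaussIso_one_sub (p : ℝ) : gaussIso (1 - p) = gaussIso p := by
  by_cases hp : p ∈ Set.Ioo (0 : ℝ) 1
  · rw [gaussIso_of_mem hp, gaussIso_of_mem ⟨by linarith [hp.2], by linarith [hp.1]⟩,
      gaussQuantile_one_sub hp, gaussianPDFReal_neg]
  · rw [gaussIso_of_notMem hp, gaussIso_of_notMem]
    exact fun h => hp ⟨by linarith [h.2], by linarith [h.1]⟩

theorem hasDerivAt_gaussQuantile {p : ℝ} (hp : p ∈ Set.Ioo (0 : ℝ) 1) :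
    HasDerivAt gaussQuantile (gaussIso p)⁻¹ p := by
  have hnhds : Set.Ioo (0 : ℝ) 1 ∈ 𝓝 p := Ioo_mem_nhds hp.1 hp.2
  have hc : ContinuousAt gaussQuantile p := by
    apply continuousAt_of_monotoneOn_of_image_mem_nhds strictMonoOn_gaussQuantile.monotoneOn hnhds
    have : gaussQuantile '' Set.Ioo 0 1 = Set.univ := Set.eq_univ_of_forall fun t =>
      ⟨gaussCdf t, ⟨gaussCdf_pos t, gaussCdf_lt_one t⟩, gaussQuantile_gaussCdf t⟩
    rw [this]; exact univ_mem
  rw [gaussIso_of_mem hp]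
  refine HasDerivAt.of_local_left_inverse hc (hasDerivAt_gaussCdf _)
    (gaussianPDFReal_zero_one_pos _).ne' ?_
  filter_upwards [hnhds] with r hr using gaussCdf_gaussQuantile hr

/-- Since φ' = -xφ and Φ⁻¹ has derivative 1/I, the density cancels in the chain rule. One more
derivative gives I I'' = -1, the identity behind all later estimates. -/
theorem hasDerivAt_gaussIso {p : ℝ} (hp : p ∈ Set.Ioo (0 : ℝ) 1) :
    HasDerivAt gaussIso (-gaussQuantile p) p := by
  have h := (hasDerivAt_gaussianPDFReal (gaussQuantile p)).comp p (hasDerivAt_gaussQuantile hp)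
  have h2 : HasDerivAt (gaussianPDFReal 0 1 ∘ gaussQuantile) (-gaussQuantile p) p := by
    refine HasDerivAt.congr_deriv h ?_
    rw [← gaussIso_of_mem hp, mul_assoc, mul_inv_cancel₀ (gaussIso_pos hp).ne', mul_one]
  refine h2.congr_of_eventuallyEq ?_
  filter_upwards [Ioo_mem_nhds hp.1 hp.2] with r hr using gaussIso_of_mem hr

theorem continuousAt_gaussIso_zero : ContinuousAt gaussIso 0 := by
  rw [ContinuousAt, gaussIso_of_notMem (by simp), Metric.tendsto_nhds]
  intro ε hε
  obtain ⟨t, ht⟩ := eventually_atBot.1 (tendsto_gaussianPDFReal_atBot.eventually_lt_const hε)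
  -- Below `gaussCdf t` the quantile lies below t, where the density is under ε; for p ≤ 0 the
  -- default value 0 applies.
  filter_upwards [Iio_mem_nhds (gaussCdf_pos t)] with p hp
  rw [Real.dist_eq, sub_zero, abs_of_nonneg (gaussIso_nonneg p)]
  by_cases h : p ∈ Set.Ioo (0 : ℝ) 1
  · rw [gaussIso_of_mem h]
    apply ht
    rw [← strictMono_gaussCdf.le_iff_le, gaussCdf_gaussQuantile h]
    exact le_of_lt hp
  · rwa [gaussIso_of_notMem h]

theorem continuous_gaussIso : Continuous gaussIso := by
  rw [continuous_iff_continuousAt]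
  intro p
  rcases lt_trichotomy p 0 with h | rfl | h
  · have : gaussIso =ᶠ[𝓝 p] fun _ => 0 := by
      filter_upwards [Iio_mem_nhds h] with r hr
      exact gaussIso_of_notMem fun h' => lt_asymm hr h'.1
    exact continuousAt_const.congr this.symm
  · exact continuousAt_gaussIso_zero
  rcases lt_trichotomy p 1 with h' | rfl | h'
  · exact (hasDerivAt_gaussIso ⟨h, h'⟩).continuousAt
  · have h1 : gaussIso = gaussIso ∘ fun p => 1 - p := by ext p; simp [gaussIso_one_sub]
    rw [h1]
    apply ContinuousAt.comp
    · simpa using continuousAt_gaussIso_zero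
    · fun_prop
  · have : gaussIso =ᶠ[𝓝 p] fun _ => 0 := by
      filter_upwards [Ioi_mem_nhds h'] with r hr
      exact gaussIso_of_notMem fun h' => lt_asymm hr h'.2
    exact continuousAt_const.congr this.symm

/-! ### Convexity estimates for I² and the two-point inequality -/

theorem hasDerivAt_gaussIso_sq {p : ℝ} (hp : p ∈ Set.Ioo (0 : ℝ) 1) :
    HasDerivAt (fun p => gaussIso p ^ 2) (-2 * gaussIso p * gaussQuantile p) p := by
  refine HasDerivAt.congr_deriv ((hasDerivAt_gaussIso hp).pow 2) ?_
  push_cast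
  ring

theorem hasDerivAt_deriv_gaussIso_sq {p : ℝ} (hp : p ∈ Set.Ioo (0 : ℝ) 1) :
    HasDerivAt (fun p => -2 * gaussIso p * gaussQuantile p) (2 * gaussQuantile p ^ 2 - 2) p := by
  have := (((hasDerivAt_gaussIso hp).const_mul (-2)).mul (hasDerivAt_gaussQuantile hp))
  refine HasDerivAt.congr_deriv this ?_
  have := (gaussIso_pos hp).ne'
  field_simp
  ring

/-- The function I² + p² has second derivative 2(Φ⁻¹)² ≥ 0, so it lies below its chord over [0,1],
which is p because I vanishes at both ends. -/
theorem gaussIso_sq_le {p : ℝ} (hp : p ∈ Set.Icc (0 : ℝ) 1) : gaussIso p ^ 2 ≤ p * (1 - p) := by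
  have hconv : ConvexOn ℝ (Set.Icc (0 : ℝ) 1) (fun p => gaussIso p ^ 2 + p ^ 2) := by
    refine convexOn_of_hasDerivWithinAt2_nonneg (convex_Icc 0 1)
      (f' := fun p => -2 * gaussIso p * gaussQuantile p + 2 * p)
      (f'' := fun p => 2 * gaussQuantile p ^ 2 - 2 + 2) ?_ ?_ ?_ ?_
    · exact ((continuous_gaussIso.pow 2).add (continuous_pow 2)).continuousOn
    · intro x hx
      rw [interior_Icc] at hx
      refine (HasDerivAt.congr_deriv
        ((hasDerivAt_gaussIso_sq hx).add (hasDerivAt_pow 2 x)) ?_).hasDerivWithinAt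
      simp
    · intro x hx
      rw [interior_Icc] at hx
      refine (HasDerivAt.congr_deriv ((hasDerivAt_deriv_gaussIso_sq hx).add
        ((hasDerivAt_id x).const_mul 2)) ?_).hasDerivWithinAt
      simp
    · intro x _
      have := sq_nonneg (gaussQuantile x)
      linarith
  have h := hconv.2 (Set.left_mem_Icc.2 zero_le_one) (Set.right_mem_Icc.2 zero_le_one)
    (sub_nonneg.2 hp.2) hp.1 (by ring)
  simp only [smul_eq_mul] at h
  rw [gaussIso_of_notMem (by simp : (0 : ℝ) ∉ _), gaussIso_of_notMem (by simp : (1 : ℝ) ∉ _)] at h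
  have h2 : (1 - p) * 0 + p * 1 = p := by ring
  rw [h2] at h
  nlinarith

theorem tangent_le_of_deriv2_nonneg {f f' f'' : ℝ → ℝ} {s : Set ℝ} (hs : Convex ℝ s)
    (ho : IsOpen s) (hf : ∀ x ∈ s, HasDerivAt f (f' x) x) (hf' : ∀ x ∈ s, HasDerivAt f' (f'' x) x)
    (h0 : ∀ x ∈ s, 0 ≤ f'' x) {x y : ℝ} (hx : x ∈ s) (hy : y ∈ s) :
    f x + f' x * (y - x) ≤ f y := by
  have hconv : ConvexOn ℝ s f := by
    refine convexOn_of_hasDerivWithinAt2_nonneg hs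
      (fun x hx => (hf x hx).continuousAt.continuousWithinAt) (f' := f') (f'' := f'') ?_ ?_ ?_ <;>
      rw [ho.interior_eq]
    · exact fun x hx => (hf x hx).hasDerivWithinAt
    · exact fun x hx => (hf' x hx).hasDerivWithinAt
    · exact h0
  rcases lt_trichotomy x y with h | rfl | h
  · have := hconv.le_slope_of_hasDerivAt hx hy h (hf x hx)
    rw [slope_def_field, le_div_iff₀ (by linarith)] at this
    linarith
  · simp
  · have := hconv.slope_le_of_hasDerivAt hy hx h (hf x hx)
    rw [slope_def_field, div_le_iff₀ (by linarith)] at this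
    linarith

theorem gaussQuantile_sq_tangent {c p : ℝ} (hc : c ∈ Set.Ioo (0 : ℝ) 1)
    (hp : p ∈ Set.Ioo (0 : ℝ) 1) :
    gaussQuantile c ^ 2 + 2 * gaussQuantile c / gaussIso c * (p - c) ≤ gaussQuantile p ^ 2 := by
  refine tangent_le_of_deriv2_nonneg (f := fun p => gaussQuantile p ^ 2)
    (f' := fun p => 2 * gaussQuantile p / gaussIso p)
    (f'' := fun p => 2 * (1 + gaussQuantile p ^ 2) / gaussIso p ^ 2)
    (convex_Ioo 0 1) isOpen_Ioo ?_ ?_ ?_ hc hp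
  · intro x hx
    refine HasDerivAt.congr_deriv ((hasDerivAt_gaussQuantile hx).pow 2) ?_
    simp [div_eq_mul_inv]
  · intro x hx
    have h0 := (gaussIso_pos hx).ne'
    refine HasDerivAt.congr_deriv
      (((hasDerivAt_gaussQuantile hx).const_mul 2).div (hasDerivAt_gaussIso hx) h0) ?_
    field_simp
    ring
  · intro x _
    positivity

/-- The tangent line at c of the convex function (Φ⁻¹)² bounds (I²)'' from below. Integrating twice
compares I² with a cubic, whose odd part about c cancels when the values at c + x and c - x are
added. -/
theorem gaussIso_sq_add_sub {c x : ℝ} (hc : c ∈ Set.Ioo (0 : ℝ) 1)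
    (h1 : c + x ∈ Set.Ioo (0 : ℝ) 1) (h2 : c - x ∈ Set.Ioo (0 : ℝ) 1) :
    2 * gaussQuantile c ^ 2 * x ^ 2 ≤
      gaussIso (c + x) ^ 2 + gaussIso (c - x) ^ 2 - 2 * gaussIso c ^ 2 + 2 * x ^ 2 := by
  set q := gaussQuantile c
  set k := q / gaussIso c
  -- The corrections to I² are chosen so that f'' is twice the gap between (Φ⁻¹)² and its tangent
  -- line at c; k is half the slope of that line.
  have key : ∀ {y}, y ∈ Set.Ioo (0 : ℝ) 1 → _ := fun {y} hy =>
    tangent_le_of_deriv2_nonneg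
    (f := fun p => gaussIso p ^ 2 + (1 - q ^ 2) * p ^ 2 - 2 / 3 * k * (p - c) ^ 3)
    (f' := fun p => -2 * gaussIso p * gaussQuantile p + 2 * (1 - q ^ 2) * p
      - 2 * k * (p - c) ^ 2)
    (f'' := fun p => 2 * gaussQuantile p ^ 2 - 2 + 2 * (1 - q ^ 2) - 4 * k * (p - c))
    (convex_Ioo 0 1) isOpen_Ioo (fun p hp => by
      have h := (((hasDerivAt_gaussIso_sq hp).add ((hasDerivAt_pow 2 p).const_mul (1 - q ^ 2))).sub
        ((((hasDerivAt_id p).sub_const c).pow 3).const_mul (2 / 3 * k)))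
      refine HasDerivAt.congr_deriv h ?_
      simp; ring) (fun p hp => by
      have h := (((hasDerivAt_deriv_gaussIso_sq hp).add
        ((hasDerivAt_id p).const_mul (2 * (1 - q ^ 2)))).sub
        ((((hasDerivAt_id p).sub_const c).pow 2).const_mul (2 * k)))
      refine HasDerivAt.congr_deriv h ?_
      simp; ring) (fun p hp => by
      have h := gaussQuantile_sq_tangent hc hp
      rw [mul_div_assoc] at h
      change q ^ 2 + 2 * k * (p - c) ≤ _ at h
      linarith) hc hy
  have e1 := key h1
  have e2 := key h2
  linear_combination e1 + e2

/-- For c ≤ 1/2 the function y ↦ I(c - y)² - I(c + y)² is convex on [0, c), so it lies above its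
tangent at 0, of slope 4 I(c) Φ⁻¹(c) ≤ 0. -/
theorem gaussIso_sq_sub_le {c x : ℝ} (hc : 0 < c) (hc2 : c ≤ 1 / 2) (hx : 0 ≤ x) (hxc : x < c) :
    |gaussIso (c + x) ^ 2 - gaussIso (c - x) ^ 2| ≤ 4 * gaussIso c * |gaussQuantile c| * x := by
  have hmem : ∀ y ∈ Set.Ioo (-c) c, c + y ∈ Set.Ioo (0 : ℝ) 1 := fun y hy =>
    ⟨by linarith [hy.1], by linarith [hy.2]⟩
  have hmem' : ∀ y ∈ Set.Ioo (-c) c, c - y ∈ Set.Ioo (0 : ℝ) 1 := fun y hy =>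
    ⟨by linarith [hy.2], by linarith [hy.1]⟩
  -- As c ≤ 1/2, the point c - y is at least as far from 1/2 as c + y, and |Φ⁻¹| grows with that
  -- distance.
  have hq : ∀ {y}, 0 ≤ y → y < c → |gaussQuantile (c + y)| ≤ |gaussQuantile (c - y)| := by
    intro y hy hyc
    have h1 := hmem y ⟨by linarith, hyc⟩
    have h2 := hmem' y ⟨by linarith, hyc⟩
    have h3 : 1 - (c - y) ∈ Set.Ioo (0 : ℝ) 1 := ⟨by linarith [h2.2], by linarith [h2.1]⟩
    have m1 := strictMonoOn_gaussQuantile.monotoneOn h2 h1 (by linarith)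
    have m2 := strictMonoOn_gaussQuantile.monotoneOn h1 h3 (by linarith)
    rw [gaussQuantile_one_sub h2] at m2
    rw [abs_le]
    have : -gaussQuantile (c - y) ≤ |gaussQuantile (c - y)| := neg_le_abs _
    have : gaussQuantile (c - y) ≤ -gaussQuantile (c - y) := m1.trans m2
    constructor <;> linarith
  have hcmem : c ∈ Set.Ioo (0 : ℝ) 1 := ⟨hc, by linarith⟩
  have hq0 : gaussQuantile c ≤ 0 := by
    have h3 : 1 - c ∈ Set.Ioo (0 : ℝ) 1 := ⟨by linarith, by linarith⟩
    have m2 := strictMonoOn_gaussQuantile.monotoneOn hcmem h3 (by linarith)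
    rw [gaussQuantile_one_sub hcmem] at m2
    linarith
  have hxm : x ∈ Set.Ioo (-c) c := ⟨by linarith, hxc⟩
  have hnn : 0 ≤ gaussIso (c + x) ^ 2 - gaussIso (c - x) ^ 2 := by
    have := gaussianPDFReal_le_of_abs_le (hq hx hxc)
    rw [← gaussIso_of_mem (hmem x hxm), ← gaussIso_of_mem (hmem' x hxm)] at this
    have := pow_le_pow_left₀ (gaussIso_nonneg _) this 2
    linarith
  rw [abs_of_nonneg hnn, abs_of_nonpos hq0]
  rcases hx.eq_or_lt with rfl | hxpos
  · simp
  have hconv : ConvexOn ℝ (Set.Ico 0 c) fun y => gaussIso (c - y) ^ 2 - gaussIso (c + y) ^ 2 := by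
    have hsub : ∀ y ∈ interior (Set.Ico 0 c), y ∈ Set.Ioo (-c) c := by
      rw [interior_Ico]
      exact fun y hy => ⟨by linarith [hy.1], hy.2⟩
    refine convexOn_of_hasDerivWithinAt2_nonneg (convex_Ico 0 c)
      (f' := fun y => -(-2 * gaussIso (c - y) * gaussQuantile (c - y)
        + -2 * gaussIso (c + y) * gaussQuantile (c + y)))
      (f'' := fun y => (2 * gaussQuantile (c - y) ^ 2 - 2) - (2 * gaussQuantile (c + y) ^ 2 - 2))
      ?_ ?_ ?_ ?_
    · have := continuous_gaussIso
      fun_prop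
    · intro y hy
      have h1 := HasDerivAt.comp y (hasDerivAt_gaussIso_sq (hmem y (hsub y hy)))
        ((hasDerivAt_id y).const_add c)
      have h2 := HasDerivAt.comp y (hasDerivAt_gaussIso_sq (hmem' y (hsub y hy)))
        ((hasDerivAt_id y).const_sub c)
      refine (HasDerivAt.congr_deriv (h2.sub h1) ?_).hasDerivWithinAt
      simp; ring
    · intro y hy
      have h1 := HasDerivAt.comp y (hasDerivAt_deriv_gaussIso_sq (hmem y (hsub y hy)))
        ((hasDerivAt_id y).const_add c)
      have h2 := HasDerivAt.comp y (hasDerivAt_deriv_gaussIso_sq (hmem' y (hsub y hy)))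
        ((hasDerivAt_id y).const_sub c)
      refine (HasDerivAt.congr_deriv (h2.add h1).neg ?_).hasDerivWithinAt
      simp
    · intro y hy
      rw [interior_Ico] at hy
      have := sq_le_sq.2 (hq hy.1.le hy.2)
      linarith
  have hd : HasDerivAt (fun y => gaussIso (c - y) ^ 2 - gaussIso (c + y) ^ 2)
      (4 * gaussIso c * gaussQuantile c) 0 := by
    have h1 := HasDerivAt.comp (0 : ℝ) (hasDerivAt_gaussIso_sq
      (by rwa [id, add_zero] : c + id 0 ∈ Set.Ioo (0 : ℝ) 1)) ((hasDerivAt_id (0 : ℝ)).const_add c)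
    have h2 := HasDerivAt.comp (0 : ℝ) (hasDerivAt_gaussIso_sq
      (by rwa [id, sub_zero] : c - id 0 ∈ Set.Ioo (0 : ℝ) 1)) ((hasDerivAt_id (0 : ℝ)).const_sub c)
    refine HasDerivAt.congr_deriv (h2.sub h1) ?_
    simp; ring
  have := hconv.le_slope_of_hasDerivAt (Set.left_mem_Ico.2 hc) ⟨hx, hxc⟩ hxpos hd
  rw [slope_def_field, le_div_iff₀ (by linarith)] at this
  simp only [sub_zero, add_zero, sub_self] at this
  linarith

theorem gaussIso_sq_sub_abs_le {c x : ℝ} (hc : c ∈ Set.Ioo (0 : ℝ) 1)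
    (h1 : c + x ∈ Set.Ioo (0 : ℝ) 1) (h2 : c - x ∈ Set.Ioo (0 : ℝ) 1) :
    |gaussIso (c + x) ^ 2 - gaussIso (c - x) ^ 2| ≤ 4 * gaussIso c * |gaussQuantile c| * |x| := by
  wlog hx : 0 ≤ x generalizing x
  · have := this (x := -x) (by simpa [← sub_eq_add_neg] using h2) (by simpa using h1)
      (by linarith)
    rw [abs_neg, ← sub_eq_add_neg, sub_neg_eq_add, abs_sub_comm] at this
    exact this
  rw [abs_of_nonneg hx]
  rcases le_total c (1 / 2) with h | h
  · exact gaussIso_sq_sub_le hc.1 h hx (by linarith [h2.1])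
  · have := gaussIso_sq_sub_le (c := 1 - c) (by linarith [hc.2]) (by linarith) hx
      (by linarith [h1.2])
    rw [show 1 - c + x = 1 - (c - x) by ring, show 1 - c - x = 1 - (c + x) by ring,
      gaussIso_one_sub, gaussIso_one_sub, gaussIso_one_sub, gaussQuantile_one_sub hc, abs_neg,
      abs_sub_comm] at this
    exact this

/-- With s and t the two square roots, `gaussIso_sq_add_sub` bounds s² + t² from below and
`gaussIso_sq_sub_abs_le` bounds |s² - t²| from above. Eliminating Φ⁻¹(c)² x² leaves a polynomial
inequality in s, t and I(c), incompatible with s + t < 2 I(c). -/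
theorem gaussIso_two_point_open {c x : ℝ} (hc : c ∈ Set.Ioo (0 : ℝ) 1)
    (h1 : c + x ∈ Set.Ioo (0 : ℝ) 1) (h2 : c - x ∈ Set.Ioo (0 : ℝ) 1) :
    2 * gaussIso c ≤ √(gaussIso (c + x) ^ 2 + x ^ 2) + √(gaussIso (c - x) ^ 2 + x ^ 2) := by
  have hA := gaussIso_sq_add_sub hc h1 h2
  have hB := gaussIso_sq_sub_abs_le hc h1 h2
  have hI := (gaussIso_pos hc).le
  set I := gaussIso c
  set q := gaussQuantile c
  have hu0 : 0 ≤ gaussIso (c + x) ^ 2 + x ^ 2 := by positivity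
  have hv0 : 0 ≤ gaussIso (c - x) ^ 2 + x ^ 2 := by positivity
  have hu := Real.sq_sqrt hu0
  have hv := Real.sq_sqrt hv0
  have hus := Real.sqrt_nonneg (gaussIso (c + x) ^ 2 + x ^ 2)
  have hvs := Real.sqrt_nonneg (gaussIso (c - x) ^ 2 + x ^ 2)
  set s := √(gaussIso (c + x) ^ 2 + x ^ 2)
  set t := √(gaussIso (c - x) ^ 2 + x ^ 2)
  have hA' : 2 * q ^ 2 * x ^ 2 ≤ s ^ 2 + t ^ 2 - 2 * I ^ 2 := by rw [hu, hv]; linarith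
  have hB' : (s ^ 2 - t ^ 2) ^ 2 ≤ 16 * I ^ 2 * q ^ 2 * x ^ 2 := by
    have h := pow_le_pow_left₀ (abs_nonneg _) hB 2
    rw [sq_abs, mul_pow, mul_pow, mul_pow, sq_abs, sq_abs] at h
    rw [hu, hv]
    calc _ = (gaussIso (c + x) ^ 2 - gaussIso (c - x) ^ 2) ^ 2 := by ring
      _ ≤ _ := h
      _ = _ := by ring
  have hC : (s ^ 2 - t ^ 2) ^ 2 ≤ 8 * I ^ 2 * (s ^ 2 + t ^ 2 - 2 * I ^ 2) := by
    nlinarith [mul_le_mul_of_nonneg_left hA' (by positivity : 0 ≤ 8 * I ^ 2)]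
  by_contra! hlt
  have hst : 0 ≤ s + t := by positivity
  -- `(4I² - (s+t)²)(4I² - (s-t)²) ≤ 0`, while both factors are positive
  have e1 : 0 < 4 * I ^ 2 - (s + t) ^ 2 := by nlinarith
  have e2 : 0 < 4 * I ^ 2 - (s - t) ^ 2 := by nlinarith [mul_nonneg hus hvs]
  nlinarith [mul_pos e1 e2]

/-- Bobkov's two-point inequality. -/
theorem gaussIso_two_point {a b : ℝ} (ha : a ∈ Set.Icc (0 : ℝ) 1) (hb : b ∈ Set.Icc (0 : ℝ) 1) :
    2 * gaussIso ((a + b) / 2) ≤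
      √(gaussIso a ^ 2 + ((a - b) / 2) ^ 2) + √(gaussIso b ^ 2 + ((a - b) / 2) ^ 2) := by
  have hI := continuous_gaussIso
  have hcl : IsClosed {p : ℝ × ℝ | 2 * gaussIso ((p.1 + p.2) / 2) ≤
      √(gaussIso p.1 ^ 2 + ((p.1 - p.2) / 2) ^ 2) +
      √(gaussIso p.2 ^ 2 + ((p.1 - p.2) / 2) ^ 2)} :=
    isClosed_le (by fun_prop) (by fun_prop)
  have hsub : Set.Ioo (0 : ℝ) 1 ×ˢ Set.Ioo (0 : ℝ) 1 ⊆ {p : ℝ × ℝ | 2 * gaussIso ((p.1 + p.2) / 2) ≤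
      √(gaussIso p.1 ^ 2 + ((p.1 - p.2) / 2) ^ 2) +
      √(gaussIso p.2 ^ 2 + ((p.1 - p.2) / 2) ^ 2)} := by
    rintro ⟨a, b⟩ ⟨ha, hb⟩
    have e1 : (a + b) / 2 + (a - b) / 2 = a := by ring
    have e2 : (a + b) / 2 - (a - b) / 2 = b := by ring
    have := gaussIso_two_point_open (c := (a + b) / 2) (x := (a - b) / 2)
      ⟨by linarith [ha.1, hb.1], by linarith [ha.2, hb.2]⟩ (by rwa [e1]) (by rwa [e2])
    rwa [e1, e2] at this
  have := hcl.closure_subset_iff.2 hsub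
  rw [closure_prod_eq, closure_Ioo zero_ne_one] at this
  exact this (Set.mk_mem_prod ha hb)

/-! ### Bobkov's inequality on the discrete cube -/

/-- This is the triangle inequality for the complex numbers f i + g i · I. -/
theorem sqrt_sq_sum_add_sq_sum_le {ι : Type*} (s : Finset ι) (f g : ι → ℝ) :
    √((∑ i ∈ s, f i) ^ 2 + (∑ i ∈ s, g i) ^ 2) ≤ ∑ i ∈ s, √(f i ^ 2 + g i ^ 2) := by
  simp_rw [← Complex.norm_add_mul_I]
  have : ((∑ i ∈ s, f i : ℝ) : ℂ) + ((∑ i ∈ s, g i : ℝ) : ℂ) * Complex.I =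
      ∑ i ∈ s, ((f i : ℂ) + (g i : ℂ) * Complex.I) := by
    push_cast
    rw [Finset.sum_add_distrib, Finset.sum_mul]
  rw [this]
  exact norm_sum_le _ _

/-- Flip the `i`-th bit. -/
def flipBit {N : ℕ} (i : Fin N) (ε : Fin N → Bool) : Fin N → Bool :=
  Function.update ε i (!ε i)

theorem flipBit_zero_cons {N : ℕ} (b : Bool) (ε : Fin N → Bool) :
    flipBit 0 (Fin.cons b ε : Fin (N + 1) → Bool) = Fin.cons (!b) ε := by
  simp [flipBit]

theorem flipBit_succ_cons {N : ℕ} (i : Fin N) (b : Bool) (ε : Fin N → Bool) :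
    flipBit i.succ (Fin.cons b ε : Fin (N + 1) → Bool) = Fin.cons b (flipBit i ε) := by
  simp [flipBit, Fin.cons_update]

theorem sum_cube_succ {N : ℕ} (f : (Fin (N + 1) → Bool) → ℝ) :
    ∑ ε, f ε = ∑ ε : Fin N → Bool, f (Fin.cons true ε) + ∑ ε : Fin N → Bool, f (Fin.cons false ε) := by
  rw [← (Fin.consEquiv fun _ : Fin (N + 1) => Bool).sum_comp f, Fintype.sum_prod_type,
    Fintype.sum_bool]
  rfl

/-- Induction on the dimension. The two-point inequality is applied to the means of g over the two
faces of the first bit, the induction hypothesis to each face, and the planar triangle inequality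
moves the first-bit difference under the roots. -/
theorem bobkov_cube : ∀ {N : ℕ} (g : (Fin N → Bool) → ℝ), (∀ ε, g ε ∈ Set.Icc (0 : ℝ) 1) →
    2 ^ N * gaussIso ((∑ ε, g ε) / 2 ^ N) ≤
      ∑ ε, √(gaussIso (g ε) ^ 2 + ∑ i, ((g ε - g (flipBit i ε)) / 2) ^ 2)
  | 0, g, _ => by
    simp only [pow_zero, one_mul, div_one, Finset.univ_unique, Finset.sum_singleton,
      Finset.univ_eq_empty, Finset.sum_empty, add_zero]
    rw [Real.sqrt_sq (gaussIso_nonneg _)]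
  | N + 1, g, hg => by
    set m : Bool → ℝ := fun b => (∑ ε : Fin N → Bool, g (Fin.cons b ε)) / 2 ^ N with hm
    have hmem : ∀ b, m b ∈ Set.Icc (0 : ℝ) 1 := by
      intro b
      constructor
      · exact div_nonneg (Finset.sum_nonneg fun ε _ => (hg _).1) (by positivity)
      · rw [div_le_one (by positivity)]
        refine (Finset.sum_le_card_nsmul _ _ 1 fun ε _ => (hg _).2).trans ?_
        simp
    have hpos : (0 : ℝ) < 2 ^ N := by positivity
    have key : ∀ b, 2 ^ N * √(gaussIso (m b) ^ 2 + ((m true - m false) / 2) ^ 2) ≤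
        ∑ ε : Fin N → Bool, √(gaussIso (g (Fin.cons b ε)) ^ 2 +
          ∑ i, ((g (Fin.cons b ε) - g (flipBit i (Fin.cons b ε : Fin (N + 1) → Bool))) / 2) ^ 2) := by
      intro b
      have ih := bobkov_cube (fun ε : Fin N → Bool => g (Fin.cons b ε)) fun ε => hg _
      set S : (Fin N → Bool) → ℝ := fun ε => √(gaussIso (g (Fin.cons b ε)) ^ 2 +
        ∑ i, ((g (Fin.cons b ε) - g (Fin.cons b (flipBit i ε))) / 2) ^ 2) with hS
      set D : (Fin N → Bool) → ℝ := fun ε => (g (Fin.cons b ε) - g (Fin.cons (!b) ε)) / 2 with hD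
      -- Half the gap between the face means is, up to a sign lost in squaring, the average of the
      -- first-bit differences D.
      have hsq : (((m true - m false) / 2) ^ 2 : ℝ) = ((∑ ε, D ε) / 2 ^ N) ^ 2 := by
        have : ∑ ε, D ε = 2 ^ N * ((m b - m (!b)) / 2) := by
          rw [hD, ← Finset.sum_div, Finset.sum_sub_distrib, hm]
          field_simp
        rw [this]
        field_simp
        cases b with
        | true => simp
        | false => simp; ring
      calc 2 ^ N * √(gaussIso (m b) ^ 2 + ((m true - m false) / 2) ^ 2)
          = √((2 ^ N * gaussIso (m b)) ^ 2 + (∑ ε, D ε) ^ 2) := by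
            rw [hsq, ← Real.sqrt_sq hpos.le, ← Real.sqrt_mul (by positivity),
              Real.sqrt_sq hpos.le]
            congr 1
            field_simp
        _ ≤ √((∑ ε, S ε) ^ 2 + (∑ ε, D ε) ^ 2) := by
            have h0 : 0 ≤ 2 ^ N * gaussIso (m b) := mul_nonneg hpos.le (gaussIso_nonneg _)
            gcongr
        _ ≤ ∑ ε, √(S ε ^ 2 + D ε ^ 2) := sqrt_sq_sum_add_sq_sum_le _ _ _
        _ = _ := by
            refine Finset.sum_congr rfl fun ε _ => ?_
            rw [hS, Real.sq_sqrt (by positivity), Fin.sum_univ_succ, flipBit_zero_cons]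
            simp_rw [flipBit_succ_cons]
            congr 1
            ring
    have h2 := gaussIso_two_point (hmem true) (hmem false)
    rw [sum_cube_succ, sum_cube_succ]
    have e : (∑ ε : Fin N → Bool, g (Fin.cons true ε) + ∑ ε : Fin N → Bool, g (Fin.cons false ε)) /
        2 ^ (N + 1) = (m true + m false) / 2 := by
      rw [hm, pow_succ]; field_simp
    rw [e, pow_succ, mul_assoc]
    refine (mul_le_mul_of_nonneg_left h2 hpos.le).trans ?_
    rw [mul_add]
    exact add_le_add (key true) (key false)

/-! ### From the cube to Gauss space -/

/-- `G` is a gradient of `F`, with a uniform quadratic error in the first-order expansion. -/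
def HasUniformGradient {d : ℕ} (F : EuclideanSpace ℝ (Fin d) → ℝ)
    (G : EuclideanSpace ℝ (Fin d) → EuclideanSpace ℝ (Fin d)) : Prop :=
  ∃ C r : ℝ, 0 ≤ C ∧ 0 < r ∧ ∀ x h, ‖h‖ ≤ r → |F (x + h) - F x - inner ℝ (G x) h| ≤ C * ‖h‖ ^ 2

namespace HasUniformGradient

variable {d : ℕ} {F : EuclideanSpace ℝ (Fin d) → ℝ}
  {G : EuclideanSpace ℝ (Fin d) → EuclideanSpace ℝ (Fin d)}

theorem hasFDerivAt (h : HasUniformGradient F G) (x : EuclideanSpace ℝ (Fin d)) :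
    HasFDerivAt F (innerSL ℝ (G x)) x := by
  obtain ⟨C, r, hC, hr, hT⟩ := h
  rw [hasFDerivAt_iff_isLittleO_nhds_zero]
  have h1 : (fun h => F (x + h) - F x - innerSL ℝ (G x) h) =O[𝓝 0] fun h => ‖h‖ ^ 2 := by
    refine Asymptotics.IsBigO.of_bound C ?_
    filter_upwards [Metric.closedBall_mem_nhds 0 hr] with h hh
    rw [mem_closedBall_zero_iff] at hh
    simpa using hT x h hh
  refine h1.trans_isLittleO ?_
  have := (Asymptotics.isLittleO_norm_pow_id (E' := EuclideanSpace ℝ (Fin d)) one_lt_two)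
  exact this

theorem continuous_left (h : HasUniformGradient F G) : Continuous F :=
  continuous_iff_continuousAt.2 fun x => (h.hasFDerivAt x).continuousAt

/-- A step of length r along G changes F by r‖G‖ up to an error C r², while F varies by at most 1.
-/
theorem exists_norm_le (h : HasUniformGradient F G) (hF : ∀ x, F x ∈ Set.Icc (0 : ℝ) 1) :
    ∃ M, ∀ x, ‖G x‖ ≤ M := by
  obtain ⟨C, r, hC, hr, hT⟩ := h
  refine ⟨(1 + C * r ^ 2) / r, fun x => ?_⟩
  rcases eq_or_ne (G x) 0 with h0 | h0
  · rw [h0, norm_zero]; positivity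
  have hn : 0 < ‖G x‖ := norm_pos_iff.2 h0
  have hnorm : ‖(r / ‖G x‖) • G x‖ = r := by
    rw [norm_smul, Real.norm_of_nonneg (by positivity)]; field_simp
  have := hT x ((r / ‖G x‖) • G x) hnorm.le
  rw [hnorm, inner_smul_right, real_inner_self_eq_norm_sq] at this
  have e : r / ‖G x‖ * ‖G x‖ ^ 2 = r * ‖G x‖ := by field_simp
  rw [e] at this
  have h1 := (abs_le.1 this).1
  rw [le_div_iff₀ hr]
  linarith [(hF x).1, (hF (x + (r / ‖G x‖) • G x)).2]

/-- G is locally Lipschitz. For e of length ‖h‖ along G(x + h) - G(x), F(x + h + e) is expanded both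
at x + h and at x, and F(x + h) at x. The errors add to at most C(1 + 4 + 1)‖h‖². -/
theorem continuous_right (h : HasUniformGradient F G) : Continuous G := by
  obtain ⟨C, r, hC, hr, hT⟩ := h
  have key : ∀ x h, ‖h‖ ≤ r / 2 → ‖G (x + h) - G x‖ ≤ 6 * C * ‖h‖ := by
    intro x h hh
    rcases eq_or_ne (G (x + h) - G x) 0 with h0 | h0
    · rw [h0, norm_zero]; positivity
    rcases eq_or_ne h 0 with rfl | hh0
    · simp
    have hn : 0 < ‖G (x + h) - G x‖ := norm_pos_iff.2 h0
    have hhn : 0 < ‖h‖ := norm_pos_iff.2 hh0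
    set D := G (x + h) - G x
    set e := (‖h‖ / ‖D‖) • D
    have hnorm : ‖e‖ = ‖h‖ := by
      rw [norm_smul, Real.norm_of_nonneg (by positivity)]; field_simp
    have hadd : ‖h + e‖ ≤ 2 * ‖h‖ := (norm_add_le _ _).trans (by rw [hnorm]; linarith)
    have t1 := abs_le.1 (hT (x + h) e (by linarith))
    have t2 := abs_le.1 (hT x (h + e) (by linarith))
    have t3 := abs_le.1 (hT x h (by linarith))
    rw [inner_add_right, ← add_assoc] at t2
    rw [hnorm] at t1
    have hsq : C * ‖h + e‖ ^ 2 ≤ C * (2 * ‖h‖) ^ 2 := by gcongr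
    have hin : inner ℝ (G (x + h)) e - inner ℝ (G x) e = ‖h‖ * ‖D‖ := by
      rw [← inner_sub_left]
      change inner ℝ D e = _
      rw [inner_smul_right, real_inner_self_eq_norm_sq]
      field_simp
    have : ‖h‖ * ‖D‖ ≤ ‖h‖ * (6 * C * ‖h‖) := by nlinarith [t1.1, t1.2, t2.1, t2.2, t3.1, t3.2]
    exact le_of_mul_le_mul_left this hhn
  rw [continuous_iff_continuousAt]
  intro x
  rw [ContinuousAt, tendsto_iff_norm_sub_tendsto_zero]
  have hlim : Tendsto (fun y => 6 * C * ‖y - x‖) (𝓝 x) (𝓝 0) := by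
    have : Continuous fun y => 6 * C * ‖y - x‖ := by fun_prop
    simpa using this.tendsto x
  refine squeeze_zero' (Eventually.of_forall fun _ => norm_nonneg _) ?_ hlim
  filter_upwards [Metric.closedBall_mem_nhds x (by positivity : 0 < r / 2)] with y hy
  rw [mem_closedBall_iff_norm] at hy
  have := key x (y - x) hy
  rwa [add_sub_cancel] at this

end HasUniformGradient

/-- The sign `±1` attached to a bit. -/
def bitSign (b : Bool) : ℝ := if b then 1 else -1

theorem bitSign_sq (b : Bool) : bitSign b ^ 2 = 1 := by cases b <;> simp [bitSign]

theorem abs_bitSign (b : Bool) : |bitSign b| = 1 := by cases b <;> simp [bitSign]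

/-- The signed sum `∑ i, ± v i`. -/
def signSum {d N : ℕ} (v : Fin N → EuclideanSpace ℝ (Fin d)) (ε : Fin N → Bool) :
    EuclideanSpace ℝ (Fin d) := ∑ i, bitSign (ε i) • v i

theorem signSum_flipBit {d N : ℕ} (v : Fin N → EuclideanSpace ℝ (Fin d)) (ε : Fin N → Bool)
    (i : Fin N) : signSum v (flipBit i ε) = signSum v ε + (-2 * bitSign (ε i)) • v i := by
  unfold signSum
  rw [← Finset.add_sum_erase _ _ (Finset.mem_univ i), ← Finset.add_sum_erase _
    (fun j => bitSign (ε j) • v j) (Finset.mem_univ i)]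
  have : ∑ j ∈ Finset.univ.erase i, bitSign (flipBit i ε j) • v j =
      ∑ j ∈ Finset.univ.erase i, bitSign (ε j) • v j := by
    refine Finset.sum_congr rfl fun j hj => ?_
    rw [flipBit, Function.update_of_ne (Finset.ne_of_mem_erase hj)]
  rw [this, add_right_comm, ← add_smul]
  congr 2
  simp only [flipBit, Function.update_self]
  cases ε i <;> norm_num [bitSign]

theorem sqrt_sum_add_sq_le {N : ℕ} (b e : Fin N → ℝ) :
    √(∑ i, (b i + e i) ^ 2) ≤ √(∑ i, b i ^ 2) + √(∑ i, e i ^ 2) := by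
  have := norm_add_le (WithLp.toLp 2 b : EuclideanSpace ℝ (Fin N)) (WithLp.toLp 2 e)
  simpa [EuclideanSpace.norm_eq] using this

theorem sqrt_sq_add_sum_le {N : ℕ} (a : ℝ) (b e : Fin N → ℝ) :
    √(a ^ 2 + ∑ i, (b i + e i) ^ 2) ≤ √(a ^ 2 + ∑ i, b i ^ 2) + √(∑ i, e i ^ 2) := by
  have h1 := sqrt_sum_add_sq_le b e
  have hb : 0 ≤ ∑ i, b i ^ 2 := Finset.sum_nonneg fun i _ => sq_nonneg _
  have hbe : 0 ≤ ∑ i, (b i + e i) ^ 2 := Finset.sum_nonneg fun i _ => sq_nonneg _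
  have hB : √(∑ i, b i ^ 2) ≤ √(a ^ 2 + ∑ i, b i ^ 2) :=
    Real.sqrt_le_sqrt (by nlinarith [sq_nonneg a])
  have h2 := Real.sq_sqrt hb
  have h3 := Real.sq_sqrt hbe
  have h4 := Real.sq_sqrt (by positivity : 0 ≤ a ^ 2 + ∑ i, b i ^ 2)
  have h5 := Real.sqrt_nonneg (∑ i, e i ^ 2)
  have h6 := Real.sqrt_nonneg (∑ i, b i ^ 2)
  have h7 := pow_le_pow_left₀ (Real.sqrt_nonneg _) h1 2
  apply Real.sqrt_le_iff.2
  refine ⟨by positivity, ?_⟩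
  nlinarith [mul_le_mul_of_nonneg_right hB h5]

/-- Flipping bit i moves the signed sum by 2 v i up to sign, so the half difference of F is ±⟨G, v
i⟩ up to C(2s)²/2 = 2Cs². The sign disappears on squaring, and the errors form a vector added inside
a Euclidean norm. -/
theorem bobkov_signSum {d N : ℕ} {F : EuclideanSpace ℝ (Fin d) → ℝ}
    {G : EuclideanSpace ℝ (Fin d) → EuclideanSpace ℝ (Fin d)} (hF : ∀ x, F x ∈ Set.Icc (0 : ℝ) 1)
    {C r : ℝ} (hT : ∀ x h, ‖h‖ ≤ r → |F (x + h) - F x - inner ℝ (G x) h| ≤ C * ‖h‖ ^ 2)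
    (v : Fin N → EuclideanSpace ℝ (Fin d)) {s : ℝ} (hv : ∀ i, ‖v i‖ = s) (hs : 2 * s ≤ r) :
    2 ^ N * gaussIso ((∑ ε, F (signSum v ε)) / 2 ^ N) ≤
      ∑ ε, (√(gaussIso (F (signSum v ε)) ^ 2 + ∑ i, inner ℝ (G (signSum v ε)) (v i) ^ 2)
        + √(N * (2 * C * s ^ 2) ^ 2)) := by
  refine (bobkov_cube (fun ε => F (signSum v ε)) fun ε => hF _).trans ?_
  refine Finset.sum_le_sum fun ε _ => ?_
  set x := signSum v ε
  set b : Fin N → ℝ := fun i => bitSign (ε i) * inner ℝ (G x) (v i)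
  set e : Fin N → ℝ := fun i => (F x - F (signSum v (flipBit i ε))) / 2 - b i
  have hb : ∑ i, inner ℝ (G x) (v i) ^ 2 = ∑ i, b i ^ 2 := by
    refine Finset.sum_congr rfl fun i _ => ?_
    simp only [b, mul_pow, bitSign_sq, one_mul]
  have he : ∀ i, e i ^ 2 ≤ (2 * C * s ^ 2) ^ 2 := by
    intro i
    have hn : ‖(-2 * bitSign (ε i)) • v i‖ = 2 * s := by
      rw [norm_smul, norm_mul, Real.norm_eq_abs, Real.norm_eq_abs, abs_bitSign, hv]
      norm_num
    have := hT x ((-2 * bitSign (ε i)) • v i) (by rw [hn]; exact hs)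
    rw [hn, ← signSum_flipBit, inner_smul_right] at this
    rw [sq_le_sq]
    refine le_trans ?_ (le_abs_self _)
    rw [abs_le] at this ⊢
    simp only [e, b]
    constructor <;> linarith [this.1, this.2]
  have e1 : ∀ i, (F x - F (signSum v (flipBit i ε))) / 2 = b i + e i := fun i => by simp [e]
  simp_rw [e1]
  rw [hb]
  refine (sqrt_sq_add_sum_le _ b e).trans ?_
  gcongr
  refine (Finset.sum_le_card_nsmul _ _ _ fun i _ => he i).trans ?_
  simp

/-- The law of a uniformly random signed sum of the vectors `v i`. -/
noncomputable def signSumLaw {d N : ℕ} (v : Fin N → EuclideanSpace ℝ (Fin d)) :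
    Measure (EuclideanSpace ℝ (Fin d)) :=
  ((2 : ℝ≥0∞) ^ N)⁻¹ • ∑ ε, Measure.dirac (signSum v ε)

theorem integral_signSumLaw {d N : ℕ} {H : Type*} [NormedAddCommGroup H] [NormedSpace ℝ H]
    [CompleteSpace H] (v : Fin N → EuclideanSpace ℝ (Fin d))
    (f : EuclideanSpace ℝ (Fin d) → H) :
    ∫ x, f x ∂(signSumLaw v) = ((2 : ℝ) ^ N)⁻¹ • ∑ ε, f (signSum v ε) := by
  rw [signSumLaw, integral_smul_measure, integral_finsetSum_measure]
  · simp
  · intro ε _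
    exact integrable_dirac (by simp)

instance isProbabilityMeasure_signSumLaw {d N : ℕ} (v : Fin N → EuclideanSpace ℝ (Fin d)) :
    IsProbabilityMeasure (signSumLaw v) := by
  constructor
  simp only [signSumLaw, Measure.smul_apply, Measure.finsetSum_apply, measure_univ,
    Finset.sum_const, Finset.card_univ, Fintype.card_fun, Fintype.card_bool, Fintype.card_fin,
    smul_eq_mul, nsmul_eq_mul, mul_one]
  push_cast
  exact ENNReal.inv_mul_cancel (by simp) (by simp)

theorem charFun_signSumLaw {d N : ℕ} (v : Fin N → EuclideanSpace ℝ (Fin d))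
    (t : EuclideanSpace ℝ (Fin d)) :
    charFun (signSumLaw v) t = ((∏ i, Real.cos (inner ℝ (v i) t) : ℝ) : ℂ) := by
  have h1 : ∀ i, ∑ b : Bool, Complex.exp (bitSign b * (inner ℝ (v i) t : ℝ) * Complex.I) =
      2 * (Real.cos (inner ℝ (v i) t) : ℂ) := by
    intro i
    rw [Fintype.sum_bool, Complex.ofReal_cos, Complex.cos]
    simp [bitSign]
    ring
  rw [charFun_apply, integral_signSumLaw]
  have h2 : ∀ ε, Complex.exp ((inner ℝ (signSum v ε) t : ℝ) * Complex.I) =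
      ∏ i, Complex.exp (bitSign (ε i) * (inner ℝ (v i) t : ℝ) * Complex.I) := by
    intro ε
    rw [← Complex.exp_sum, ← Finset.sum_mul, signSum, sum_inner]
    push_cast
    simp_rw [inner_smul_left]
    simp
  simp_rw [h2]
  have h3 := Finset.prod_univ_sum (fun _ : Fin N => (Finset.univ : Finset Bool)) fun i b =>
    Complex.exp (bitSign b * (inner ℝ (v i) t : ℝ) * Complex.I)
  rw [Fintype.piFinset_univ] at h3
  rw [← h3]
  simp_rw [h1]
  rw [Finset.prod_mul_distrib]
  simp

/-- Since n(cos(a/√n) - 1) tends to -a²/2, the claim is the limit of (1 + x/n)^n with convergent x.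
-/
theorem tendsto_cos_div_sqrt_pow (a : ℝ) :
    Tendsto (fun n : ℕ => Real.cos (a / √n) ^ n) atTop (𝓝 (Real.exp (-a ^ 2 / 2))) := by
  have h : Tendsto (fun n : ℕ => (n : ℝ) * (Real.cos (a / √n) - 1)) atTop (𝓝 (-a ^ 2 / 2)) := by
    rw [tendsto_iff_norm_sub_tendsto_zero]
    -- The constant 5/96 is the one in the quartic remainder of `Real.cos_bound`.
    have hlim : Tendsto (fun n : ℕ => a ^ 4 * (5 / 96) / (n : ℝ)) atTop (𝓝 0) :=
      tendsto_const_div_atTop_nhds_zero_nat _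
    refine squeeze_zero' (Eventually.of_forall fun _ => norm_nonneg _) ?_ hlim
    obtain ⟨m, hm⟩ := exists_nat_ge (a ^ 2)
    filter_upwards [eventually_ge_atTop (max m 1)] with n hn
    have hn1 : (1 : ℝ) ≤ n := by exact_mod_cast (le_max_right m 1).trans hn
    have hnm : a ^ 2 ≤ n := hm.trans (by exact_mod_cast (le_max_left m 1).trans hn)
    have hs := Real.sq_sqrt (by linarith : (0 : ℝ) ≤ n)
    have hx2 : (a / √n) ^ 2 = a ^ 2 / n := by rw [div_pow, hs]
    have hle : |a / √n| ≤ 1 := by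
      rw [← sq_le_one_iff_abs_le_one, hx2, div_le_one (by linarith)]
      exact hnm
    have := Real.cos_bound hle
    rw [show |a / √n| ^ 4 = (|a / √n| ^ 2) ^ 2 by ring, sq_abs, hx2] at this
    have e : (n : ℝ) * (Real.cos (a / √n) - 1) - -a ^ 2 / 2 =
        n * (Real.cos (a / √n) - (1 - a ^ 2 / n / 2)) := by field_simp; ring
    rw [e, norm_mul, Real.norm_of_nonneg (by linarith), Real.norm_eq_abs]
    refine (mul_le_mul_of_nonneg_left this (by linarith)).trans (le_of_eq ?_)
    field_simp
  have := Real.tendsto_one_add_pow_exp_of_tendsto h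
  simpa using this

/-- The vectors `e_j / √n`, each repeated `n` times. -/
noncomputable def scaledBasis (d n : ℕ) (k : Fin (d * n)) : EuclideanSpace ℝ (Fin d) :=
  (√n)⁻¹ • EuclideanSpace.single (finProdFinEquiv.symm k).1 (1 : ℝ)

theorem norm_scaledBasis (d n : ℕ) (k : Fin (d * n)) : ‖scaledBasis d n k‖ = (√n)⁻¹ := by
  simp [scaledBasis, norm_smul, abs_of_nonneg]

theorem inner_scaledBasis_right (d n : ℕ) (k : Fin (d * n)) (x : EuclideanSpace ℝ (Fin d)) :
    inner ℝ x (scaledBasis d n k) = x (finProdFinEquiv.symm k).1 / √n := by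
  simp [scaledBasis, inner_smul_right, EuclideanSpace.inner_single_right, div_eq_inv_mul]

theorem sum_inner_scaledBasis_sq {d n : ℕ} (hn : n ≠ 0) (x : EuclideanSpace ℝ (Fin d)) :
    ∑ k, inner ℝ x (scaledBasis d n k) ^ 2 = ‖x‖ ^ 2 := by
  simp_rw [inner_scaledBasis_right]
  rw [finProdFinEquiv.symm.sum_comp (fun p : Fin d × Fin n => (x p.1 / √n) ^ 2),
    Fintype.sum_prod_type, EuclideanSpace.norm_sq_eq]
  refine Finset.sum_congr rfl fun j _ => ?_
  have : (n : ℝ) ≠ 0 := by exact_mod_cast hn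
  simp [div_pow]
  field_simp

/-- The standard Gaussian measure as a bundled probability measure. -/
noncomputable def gaussProbMeasure (d : ℕ) : ProbabilityMeasure (EuclideanSpace ℝ (Fin d)) :=
  ⟨gaussMeasure d, inferInstance⟩

/-- `signSumLaw` as a bundled probability measure. -/
noncomputable def signSumProbLaw {d N : ℕ} (v : Fin N → EuclideanSpace ℝ (Fin d)) :
    ProbabilityMeasure (EuclideanSpace ℝ (Fin d)) := ⟨signSumLaw v, inferInstance⟩

/-- A central limit theorem for normalized random sign vectors. -/
theorem tendsto_signSumProbLaw (d : ℕ) :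
    Tendsto (fun n : ℕ => signSumProbLaw (scaledBasis d n)) atTop (𝓝 (gaussProbMeasure d)) := by
  refine ProbabilityMeasure.tendsto_of_tendsto_charFun fun t => ?_
  simp only [signSumProbLaw, gaussProbMeasure, ProbabilityMeasure.coe_mk, charFun_signSumLaw,
    charFun_stdGaussian]
  have h1 : ∀ n : ℕ, ∏ k, Real.cos (inner ℝ (scaledBasis d n k) t) =
      ∏ j, Real.cos (t j / √n) ^ n := by
    intro n
    simp_rw [real_inner_comm, inner_scaledBasis_right]
    rw [finProdFinEquiv.symm.prod_comp (fun p : Fin d × Fin n => Real.cos (t p.1 / √n)),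
      Fintype.prod_prod_type]
    simp
  simp_rw [h1]
  have h2 : Complex.exp (-(‖t‖ : ℂ) ^ 2 / 2) = ((∏ j, Real.exp (-t j ^ 2 / 2) : ℝ) : ℂ) := by
    rw [← Real.exp_sum, ← Finset.sum_div, Finset.sum_neg_distrib]
    push_cast
    congr 3
    have := EuclideanSpace.norm_sq_eq t
    simp only [Real.norm_eq_abs, sq_abs] at this
    exact_mod_cast this
  rw [h2]
  exact (Complex.continuous_ofReal.tendsto _).comp
    (tendsto_finsetProd _ fun j _ => tendsto_cos_div_sqrt_pow (t j))

/-- Bobkov's functional isoperimetric inequality in Gauss space. -/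
theorem bobkov_gaussMeasure {d : ℕ} {F : EuclideanSpace ℝ (Fin d) → ℝ}
    {G : EuclideanSpace ℝ (Fin d) → EuclideanSpace ℝ (Fin d)} (h : HasUniformGradient F G)
    (hF : ∀ x, F x ∈ Set.Icc (0 : ℝ) 1) :
    gaussIso (∫ x, F x ∂gaussMeasure d) ≤
      ∫ x, √(gaussIso (F x) ^ 2 + ‖G x‖ ^ 2) ∂gaussMeasure d := by
  have hFc := h.continuous_left
  have hGc := h.continuous_right
  obtain ⟨M, hM⟩ := h.exists_norm_le hF
  have hIc := continuous_gaussIso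
  obtain ⟨C, r, hC, hr, hT⟩ := h
  have hW := ProbabilityMeasure.tendsto_iff_forall_integral_tendsto.1 (tendsto_signSumProbLaw d)
  have l1 := hW (BoundedContinuousFunction.ofNormedAddCommGroup F hFc 1 fun x => by
    rw [Real.norm_of_nonneg (hF x).1]; exact (hF x).2)
  have l2 := hW (BoundedContinuousFunction.ofNormedAddCommGroup
    (fun x => √(gaussIso (F x) ^ 2 + ‖G x‖ ^ 2)) (by fun_prop) (√(1 + M ^ 2)) fun x => by
      rw [Real.norm_of_nonneg (Real.sqrt_nonneg _)]
      have := gaussIso_le_one (F x)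
      have := gaussIso_nonneg (F x)
      have := hM x
      gcongr
      nlinarith)
  simp only [BoundedContinuousFunction.coe_ofNormedAddCommGroup, signSumProbLaw,
    gaussProbMeasure, ProbabilityMeasure.coe_mk]
    at l1 l2
  -- With d·n vectors of length 1/√n the discretization error is 2C√(d/n).
  have l3 : Tendsto (fun n : ℕ => √((d * n : ℕ) * (2 * C * (√n)⁻¹ ^ 2) ^ 2)) atTop (𝓝 0) := by
    have h0 : Tendsto (fun n : ℕ => √(d * (2 * C) ^ 2 / (n : ℝ))) atTop (𝓝 (√0)) :=
      (Real.continuous_sqrt.tendsto _).comp (tendsto_const_div_atTop_nhds_zero_nat _)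
    rw [Real.sqrt_zero] at h0
    refine h0.congr' ?_
    filter_upwards [eventually_gt_atTop 0] with n hn
    have hn' : (0 : ℝ) < n := by exact_mod_cast hn
    congr 1
    rw [inv_pow, Real.sq_sqrt hn'.le]
    push_cast
    field_simp
  have l4 := l2.add l3
  rw [add_zero] at l4
  refine le_of_tendsto_of_tendsto ((hIc.tendsto _).comp l1) l4 ?_
  have hsmall : ∀ᶠ n : ℕ in atTop, 2 * (√(n : ℝ))⁻¹ ≤ r := by
    have : Tendsto (fun n : ℕ => 2 * (√(n : ℝ))⁻¹) atTop (𝓝 (2 * 0)) :=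
      (tendsto_inv_atTop_zero.comp
        (Real.tendsto_sqrt_atTop.comp tendsto_natCast_atTop_atTop)).const_mul 2
    rw [mul_zero] at this
    exact this.eventually_le_const hr
  filter_upwards [hsmall, eventually_gt_atTop 0] with n hn hn0
  have := bobkov_signSum hF hT (scaledBasis d n) (norm_scaledBasis d n) hn
  simp_rw [sum_inner_scaledBasis_sq hn0.ne'] at this
  rw [Finset.sum_add_distrib] at this
  simp only [Function.comp_apply, integral_signSumLaw, smul_eq_mul]
  have h2 : (0 : ℝ) < 2 ^ (d * n) := by positivity
  rw [div_eq_inv_mul, ← le_div_iff₀' h2, add_div] at this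
  refine this.trans (le_of_eq ?_)
  congr 1
  · rw [div_eq_inv_mul]
  · simp

/-! ### Rotations of Gaussian pairs and noise sensitivity -/

section Noise

variable {d : ℕ}

theorem lintegral_rotation (θ : ℝ)
    {H : EuclideanSpace ℝ (Fin d) × EuclideanSpace ℝ (Fin d) → ℝ≥0∞} (hH : Measurable H) :
    ∫⁻ p, H (Real.cos θ • p.1 + Real.sin θ • p.2, -Real.sin θ • p.1 + Real.cos θ • p.2)
      ∂((gaussMeasure d).prod (gaussMeasure d)) =
    ∫⁻ p, H p ∂((gaussMeasure d).prod (gaussMeasure d)) := by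
  have h := IsGaussian.map_rotation_eq_self (μ := gaussMeasure d) (by simp) θ
  conv_rhs => rw [← h]
  rw [lintegral_map hH (by fun_prop)]
  rfl

theorem lintegral_cos_add_sin (θ : ℝ) {H : EuclideanSpace ℝ (Fin d) → ℝ≥0∞} (hH : Measurable H) :
    ∫⁻ p, H (Real.cos θ • p.1 + Real.sin θ • p.2) ∂((gaussMeasure d).prod (gaussMeasure d)) =
      ∫⁻ x, H x ∂gaussMeasure d := by
  have := lintegral_rotation θ (H := fun p => H p.1) (hH.comp measurable_fst)
  rw [this, lintegral_prod _ (by fun_prop)]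
  simp

/-- The mean change of `f` when a Gaussian vector is rotated by the angle `θ` towards an
independent one. -/
noncomputable def noiseSens (f : EuclideanSpace ℝ (Fin d) → ℝ) (θ : ℝ) : ℝ≥0∞ :=
  ∫⁻ p, ‖f p.1 - f (Real.cos θ • p.1 + Real.sin θ • p.2)‖ₑ
    ∂((gaussMeasure d).prod (gaussMeasure d))

/-- Rotating by s + t is rotating by s and then by t. The triangle inequality goes through the
intermediate point, and the pair rotated by s has the law of the original pair. -/
theorem noiseSens_add_le {f : EuclideanSpace ℝ (Fin d) → ℝ} (hf : Measurable f) (s t : ℝ) :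
    noiseSens f (s + t) ≤ noiseSens f s + noiseSens f t := by
  have h := lintegral_rotation s
    (H := fun p => ‖f p.1 - f (Real.cos t • p.1 + Real.sin t • p.2)‖ₑ) (by fun_prop)
  unfold noiseSens
  rw [← h, ← lintegral_add_left (by fun_prop)]
  refine lintegral_mono fun p => ?_
  have e : Real.cos (s + t) • p.1 + Real.sin (s + t) • p.2 =
      Real.cos t • (Real.cos s • p.1 + Real.sin s • p.2) +
        Real.sin t • (-Real.sin s • p.1 + Real.cos s • p.2) := by
    rw [Real.cos_add, Real.sin_add]
    module
  simp only [e]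
  refine le_trans (le_of_eq ?_) (enorm_add_le _ _)
  congr 1
  ring

/-- A Gaussian vector and its rotation have the same law, so replacing f by g costs the L¹ distance
twice. -/
theorem noiseSens_le_add {f g : EuclideanSpace ℝ (Fin d) → ℝ} (hf : Measurable f)
    (hg : Measurable g) (θ : ℝ) :
    noiseSens f θ ≤ 2 * ∫⁻ x, ‖f x - g x‖ₑ ∂gaussMeasure d + noiseSens g θ := by
  have h1 := lintegral_cos_add_sin (d := d) θ (H := fun x => ‖f x - g x‖ₑ) (by fun_prop)
  have h2 : ∫⁻ p, ‖f p.1 - g p.1‖ₑ ∂((gaussMeasure d).prod (gaussMeasure d)) =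
      ∫⁻ x, ‖f x - g x‖ₑ ∂gaussMeasure d := by
    rw [lintegral_prod _ (by fun_prop)]
    simp
  unfold noiseSens
  rw [two_mul]
  nth_rw 1 [← h2]
  rw [← h1, ← lintegral_add_left (by fun_prop), ← lintegral_add_left (by fun_prop)]
  refine lintegral_mono fun p => ?_
  set y := Real.cos θ • p.1 + Real.sin θ • p.2
  have e : f p.1 - f y = (f p.1 - g p.1) + -(f y - g y) + (g p.1 - g y) := by ring
  calc ‖f p.1 - f y‖ₑ ≤ ‖(f p.1 - g p.1) + -(f y - g y)‖ₑ + ‖g p.1 - g y‖ₑ := by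
        rw [e]; exact enorm_add_le _ _
    _ ≤ ‖f p.1 - g p.1‖ₑ + ‖f y - g y‖ₑ + ‖g p.1 - g y‖ₑ := by
        gcongr
        exact (enorm_add_le _ _).trans (by rw [enorm_neg])

theorem tendsto_noiseSens_boundedContinuous
    (g : BoundedContinuousFunction (EuclideanSpace ℝ (Fin d)) ℝ) :
    Tendsto (noiseSens g) (𝓝 0) (𝓝 0) := by
  have hg := g.continuous
  have : Tendsto (noiseSens g) (𝓝 0) (𝓝 (∫⁻ _ : EuclideanSpace ℝ (Fin d) × EuclideanSpace ℝ (Fin d),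
      0 ∂((gaussMeasure d).prod (gaussMeasure d)))) := by
    refine tendsto_lintegral_filter_of_dominated_convergence (fun _ => ‖g‖ₑ + ‖g‖ₑ)
      (Eventually.of_forall fun θ => by fun_prop) (Eventually.of_forall fun θ => ?_) ?_ ?_
    · refine Eventually.of_forall fun p => ?_
      refine (enorm_sub_le).trans (add_le_add ?_ ?_) <;>
      · rw [enorm_le_iff_norm_le]
        exact g.norm_coe_le_norm _
    · simp
    · refine Eventually.of_forall fun p => ?_
      have hc : Continuous fun θ : ℝ => ‖g p.1 - g (Real.cos θ • p.1 + Real.sin θ • p.2)‖ₑ := by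
        fun_prop
      have := hc.tendsto 0
      simpa using this
  simpa using this

theorem tendsto_noiseSens {f : EuclideanSpace ℝ (Fin d) → ℝ} (hf : Measurable f)
    (hfi : Integrable f (gaussMeasure d)) : Tendsto (noiseSens f) (𝓝 0) (𝓝 0) := by
  rw [ENNReal.tendsto_nhds_zero]
  intro ε hε
  rcases eq_or_ne ε ⊤ with rfl | hε'
  · simp
  have h3 : ε / 3 ≠ 0 := (ENNReal.div_pos hε.ne' (by simp)).ne'
  obtain ⟨g, hg, -⟩ := hfi.exists_boundedContinuous_lintegral_sub_le h3
  filter_upwards [ENNReal.tendsto_nhds_zero.1 (tendsto_noiseSens_boundedContinuous g) (ε / 3)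
    (pos_iff_ne_zero.2 h3)] with θ hθ
  refine (noiseSens_le_add hf g.continuous.measurable θ).trans ?_
  calc _ ≤ 2 * (ε / 3) + ε / 3 := by gcongr
    _ = 3 * (ε / 3) := by ring
    _ = ε := ENNReal.mul_div_cancel (by simp) (by simp)

end Noise

/-- Fekete's lemma at `0`. -/
theorem tendsto_div_of_subadditive {f : ℝ → ℝ≥0∞} (hsub : ∀ s t, f (s + t) ≤ f s + f t)
    (h0 : Tendsto f (𝓝 0) (𝓝 0)) :
    Tendsto (fun δ => f δ / ENNReal.ofReal δ) (𝓝[>] 0)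
      (𝓝 (⨆ t : ℝ, ⨆ _ : 0 < t, f t / ENNReal.ofReal t)) := by
  -- The filter `𝓝 0` contains the point 0 itself, so the limit there is also the value.
  have hzero : f 0 = 0 := tendsto_nhds_unique (tendsto_pure_nhds f 0 |>.mono_right (by rfl))
    (h0.mono_left (pure_le_nhds 0))
  have hmul : ∀ (n : ℕ) (δ : ℝ), f (n * δ) ≤ n * f δ := by
    intro n δ
    induction n with
    | zero => simp [hzero]
    | succ n ih =>
      push_cast
      rw [add_mul, add_mul, one_mul, one_mul]
      exact (hsub _ _).trans (by gcongr)
  rw [tendsto_order]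
  constructor
  · intro a ha
    simp only [lt_iSup_iff] at ha
    obtain ⟨t, ht, hat⟩ := ha
    have hne : ENNReal.ofReal t ≠ 0 := by simpa using ht
    have hat' : a * ENNReal.ofReal t < f t :=
      (ENNReal.lt_div_iff_mul_lt (Or.inl hne) (Or.inl ENNReal.ofReal_ne_top)).1 hat
    have hpos : 0 < f t - a * ENNReal.ofReal t := tsub_pos_of_lt hat'
    have hev := h0.eventually_lt_const hpos
    rw [Metric.eventually_nhds_iff] at hev
    obtain ⟨η, hη, hev⟩ := hev
    filter_upwards [Ioo_mem_nhdsGT hη] with δ hδ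
    by_contra! hle
    have hδne : ENNReal.ofReal δ ≠ 0 := by simpa using hδ.1
    rw [ENNReal.div_le_iff hδne ENNReal.ofReal_ne_top] at hle
    -- The angle t is cut into ⌊t/δ⌋ steps of size δ and a remainder below δ, where f is small. A
    -- quotient at most a at δ would then contradict a < f t / t.
    have hfl := Nat.floor_le (div_pos ht hδ.1).le
    have hlt := Nat.lt_floor_add_one (t / δ)
    set n := ⌊t / δ⌋₊
    rw [le_div_iff₀ hδ.1] at hfl
    rw [div_lt_iff₀ hδ.1] at hlt
    have hr : f (t - n * δ) < f t - a * ENNReal.ofReal t := by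
      apply hev
      rw [Real.dist_eq, sub_zero, abs_of_nonneg (by linarith)]
      linarith [hδ.2]
    rw [lt_tsub_iff_left] at hr
    have h1 : f t ≤ n * f δ + f (t - n * δ) := by
      have := hsub (n * δ) (t - n * δ)
      rw [add_sub_cancel] at this
      exact this.trans (by gcongr; exact hmul n δ)
    have h2 : n * f δ ≤ a * ENNReal.ofReal t := by
      calc n * f δ ≤ n * (a * ENNReal.ofReal δ) := by gcongr
        _ = a * ENNReal.ofReal (n * δ) := by
          rw [ENNReal.ofReal_mul (by positivity), ENNReal.ofReal_natCast]; ring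
        _ ≤ _ := by gcongr
    exact absurd (h1.trans (by gcongr)) (not_le.2 hr)
  · intro a ha
    filter_upwards [self_mem_nhdsWithin] with δ hδ
    exact (le_iSup₂ (f := fun t (_ : 0 < t) => f t / ENNReal.ofReal t) δ hδ).trans_lt ha

/-! ### Existence of the derivative of the rotation sensitivity -/

section RotSens

variable {d : ℕ}

theorem rotSens_eq_noiseSens {A : Set (EuclideanSpace ℝ (Fin d))} (hA : MeasurableSet A) {θ : ℝ}
    (h0 : 0 ≤ θ) (h1 : θ ≤ Real.pi) :
    rotSens A θ = noiseSens (A.indicator fun _ => (1 : ℝ)) θ := by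
  have hS : MeasurableSet {p : EuclideanSpace ℝ (Fin d) × EuclideanSpace ℝ (Fin d) |
      ¬ (p.1 ∈ A ↔ p.2 ∈ A)} := by
    have h1 : MeasurableSet {p : EuclideanSpace ℝ (Fin d) × EuclideanSpace ℝ (Fin d) | p.1 ∈ A} :=
      measurable_fst hA
    have h2 : MeasurableSet {p : EuclideanSpace ℝ (Fin d) × EuclideanSpace ℝ (Fin d) | p.2 ∈ A} :=
      measurable_snd hA
    exact (h1.iff h2).compl
  have hm : Measurable fun p : EuclideanSpace ℝ (Fin d) × EuclideanSpace ℝ (Fin d) =>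
      (p.1, Real.cos θ • p.1 + √(1 - Real.cos θ ^ 2) • p.2) := by fun_prop
  unfold rotSens corrGaussPair noiseSens
  rw [Measure.map_apply hm hS, ← lintegral_indicator_one (hm hS)]
  refine lintegral_congr fun p => ?_
  rw [← Real.sin_eq_sqrt_one_sub_cos_sq h0 h1]
  classical
  simp only [Set.indicator_apply, Set.mem_preimage, Set.mem_ofPred_eq, Pi.one_apply]
  by_cases a : p.1 ∈ A <;> by_cases b : Real.cos θ • p.1 + Real.sin θ • p.2 ∈ A <;> simp [a, b]

/-- Both marginals of the correlated pair are Gaussian, so null sets are invisible in either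
coordinate. Writing √(1 - cos² θ) as the sine of `arccos (cos θ)` covers every θ. -/
theorem rotSens_congr {A B : Set (EuclideanSpace ℝ (Fin d))} (h : A =ᵐ[gaussMeasure d] B) (θ : ℝ) :
    rotSens A θ = rotSens B θ := by
  have hs : ∀ p : EuclideanSpace ℝ (Fin d) × EuclideanSpace ℝ (Fin d),
      Real.cos θ • p.1 + √(1 - Real.cos θ ^ 2) • p.2 =
      Real.cos (Real.arccos (Real.cos θ)) • p.1 + Real.sin (Real.arccos (Real.cos θ)) • p.2 := by
    intro p
    rw [Real.sin_arccos, Real.cos_arccos (Real.neg_one_le_cos θ) (Real.cos_le_one θ)]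
  have hm : Measurable fun p : EuclideanSpace ℝ (Fin d) × EuclideanSpace ℝ (Fin d) =>
      Real.cos θ • p.1 + √(1 - Real.cos θ ^ 2) • p.2 := by fun_prop
  have hq1 : Measure.QuasiMeasurePreserving (Prod.fst) (corrGaussPair d (Real.cos θ))
      (gaussMeasure d) := by
    refine ⟨measurable_fst, ?_⟩
    unfold corrGaussPair
    rw [Measure.map_map measurable_fst (by fun_prop)]
    exact Measure.quasiMeasurePreserving_fst.absolutelyContinuous
  have hq2 : Measure.QuasiMeasurePreserving (Prod.snd) (corrGaussPair d (Real.cos θ))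
      (gaussMeasure d) := by
    refine ⟨measurable_snd, ?_⟩
    unfold corrGaussPair
    rw [Measure.map_map measurable_snd (by fun_prop)]
    refine Measure.AbsolutelyContinuous.mk fun s hsm hs0 => ?_
    rw [Measure.map_apply (by fun_prop) hsm, ← lintegral_indicator_one (by
      exact (measurable_snd.comp (by fun_prop)) hsm)]
    have := lintegral_cos_add_sin (d := d) (Real.arccos (Real.cos θ))
      (H := s.indicator 1) (measurable_one.indicator hsm)
    rw [lintegral_indicator_one hsm, hs0] at this
    rw [← this]
    refine lintegral_congr fun p => ?_
    rw [← hs]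
    rfl
  refine measure_congr ?_
  have e1 := hq1.ae_eq h
  have e2 := hq2.ae_eq h
  filter_upwards [e1, e2] with p h1 h2
  have h1' : (p.1 ∈ A) = (p.1 ∈ B) := h1
  have h2' : (p.2 ∈ A) = (p.2 ∈ B) := h2
  exact congrArg Not (by rw [h1', h2'])

theorem rotSensQuot_eventuallyEq {A : Set (EuclideanSpace ℝ (Fin d))} (hA : MeasurableSet A) :
    rotSensQuot A =ᶠ[𝓝[>] 0] fun δ => noiseSens (A.indicator fun _ => (1 : ℝ)) δ /
      ENNReal.ofReal δ := by
  filter_upwards [Ioo_mem_nhdsGT Real.pi_pos] with δ hδ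
  rw [rotSensQuot, rotSens_eq_noiseSens hA hδ.1.le hδ.2.le]

/-- The right derivative at `0` of the rotation sensitivity exists and is a supremum. -/
theorem tendsto_rotSensQuot {A : Set (EuclideanSpace ℝ (Fin d))} (hA : MeasurableSet A) :
    Tendsto (rotSensQuot A) (𝓝[>] 0) (𝓝 (⨆ t : ℝ, ⨆ _ : 0 < t,
      noiseSens (A.indicator fun _ => (1 : ℝ)) t / ENNReal.ofReal t)) := by
  have hm : Measurable (A.indicator fun _ => (1 : ℝ)) := measurable_const.indicator hA
  have hi : Integrable (A.indicator fun _ => (1 : ℝ)) (gaussMeasure d) :=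
    (integrable_const 1).indicator hA
  exact (tendsto_div_of_subadditive (noiseSens_add_le hm) (tendsto_noiseSens hm hi)).congr'
    (rotSensQuot_eventuallyEq hA).symm

theorem rotSensDeriv_eq {A : Set (EuclideanSpace ℝ (Fin d))} (hA : MeasurableSet A) :
    rotSensDeriv A = ⨆ t : ℝ, ⨆ _ : 0 < t,
      noiseSens (A.indicator fun _ => (1 : ℝ)) t / ENNReal.ofReal t :=
  (tendsto_rotSensQuot hA).limUnder_eq

/-- The derivative is a supremum of difference quotients, hence the linear bound holds at every
positive angle. -/
theorem noiseSens_le_rotSensDeriv_mul {A : Set (EuclideanSpace ℝ (Fin d))} (hA : MeasurableSet A)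
    {t : ℝ} (ht : 0 < t) :
    noiseSens (A.indicator fun _ => (1 : ℝ)) t ≤ rotSensDeriv A * ENNReal.ofReal t := by
  rw [← ENNReal.div_le_iff (by simpa using ht) ENNReal.ofReal_ne_top, rotSensDeriv_eq hA]
  exact le_iSup₂ (f := fun t (_ : 0 < t) =>
    noiseSens (A.indicator fun _ => (1 : ℝ)) t / ENNReal.ofReal t) t ht

end RotSens

/-! ### The noise operator: mean, L¹ error and contraction of sensitivity -/

section Smoothing

variable {d : ℕ}

/-- The noise operator (Ornstein–Uhlenbeck semigroup), parametrized by the angle. -/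
noncomputable def noiseOp (s : ℝ) (f : EuclideanSpace ℝ (Fin d) → ℝ)
    (x : EuclideanSpace ℝ (Fin d)) : ℝ :=
  ∫ w, f (Real.cos s • x + Real.sin s • w) ∂gaussMeasure d

theorem integrable_of_mem_Icc {Ω : Type*} [MeasurableSpace Ω] {μ : Measure Ω} [IsFiniteMeasure μ]
    {f : Ω → ℝ} (hf : Measurable f) (h : ∀ x, f x ∈ Set.Icc (0 : ℝ) 1) : Integrable f μ :=
  Integrable.of_bound hf.aestronglyMeasurable 1 (Eventually.of_forall fun x => by
    rw [Real.norm_of_nonneg (h x).1]; exact (h x).2)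

theorem noiseOp_mem_Icc {f : EuclideanSpace ℝ (Fin d) → ℝ} (hf : Measurable f)
    (h : ∀ x, f x ∈ Set.Icc (0 : ℝ) 1) (s : ℝ) (x : EuclideanSpace ℝ (Fin d)) :
    noiseOp s f x ∈ Set.Icc (0 : ℝ) 1 := by
  refine ⟨integral_nonneg fun w => (h _).1, ?_⟩
  have := integral_mono (μ := gaussMeasure d) (integrable_of_mem_Icc
    (f := fun w => f (Real.cos s • x + Real.sin s • w)) (by fun_prop) fun w => h _)
    (integrable_const 1) fun w => (h _).2
  rw [integral_const, probReal_univ, one_smul] at this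
  exact this

theorem measurable_noiseOp {f : EuclideanSpace ℝ (Fin d) → ℝ} (hf : Measurable f) (s : ℝ) :
    Measurable (noiseOp s f) := by
  have : Measurable fun p : EuclideanSpace ℝ (Fin d) × EuclideanSpace ℝ (Fin d) =>
    f (Real.cos s • p.1 + Real.sin s • p.2) := by fun_prop
  exact (this.stronglyMeasurable.integral_prod_right).measurable

theorem integral_cos_add_sin (θ : ℝ) {f : EuclideanSpace ℝ (Fin d) → ℝ} (hf : Measurable f) :
    ∫ p, f (Real.cos θ • p.1 + Real.sin θ • p.2) ∂((gaussMeasure d).prod (gaussMeasure d)) =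
      ∫ x, f x ∂gaussMeasure d := by
  have h : MeasurePreserving (fun p : EuclideanSpace ℝ (Fin d) × EuclideanSpace ℝ (Fin d) =>
      Real.cos θ • p.1 + Real.sin θ • p.2) ((gaussMeasure d).prod (gaussMeasure d))
      (gaussMeasure d) := by
    refine ⟨by fun_prop, Measure.ext_of_lintegral _ fun H hH => ?_⟩
    rw [lintegral_map hH (by fun_prop), lintegral_cos_add_sin θ hH]
  conv_rhs => rw [← h.map_eq]
  rw [integral_map h.measurable.aemeasurable hf.aestronglyMeasurable]

theorem integral_noiseOp {f : EuclideanSpace ℝ (Fin d) → ℝ} (hf : Measurable f)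
    (h : ∀ x, f x ∈ Set.Icc (0 : ℝ) 1) (s : ℝ) :
    ∫ x, noiseOp s f x ∂gaussMeasure d = ∫ x, f x ∂gaussMeasure d := by
  rw [← integral_cos_add_sin s hf, integral_prod _ (integrable_of_mem_Icc (by fun_prop)
    fun p => h _)]
  rfl

theorem lintegral_sub_noiseOp_le {f : EuclideanSpace ℝ (Fin d) → ℝ} (hf : Measurable f)
    (h : ∀ x, f x ∈ Set.Icc (0 : ℝ) 1) (s : ℝ) :
    ∫⁻ x, ‖f x - noiseOp s f x‖ₑ ∂gaussMeasure d ≤ noiseSens f s := by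
  unfold noiseSens
  rw [lintegral_prod _ (by fun_prop)]
  refine lintegral_mono fun x => ?_
  have hi : Integrable (fun w => f (Real.cos s • x + Real.sin s • w)) (gaussMeasure d) :=
    integrable_of_mem_Icc (by fun_prop) fun w => h _
  have : f x - noiseOp s f x =
      ∫ w, (f x - f (Real.cos s • x + Real.sin s • w)) ∂gaussMeasure d := by
    rw [integral_sub (integrable_const _) hi]
    simp [noiseOp]
  simp only [this]
  exact enorm_integral_le_lintegral_enorm _

/-- Mixing by s and rotating by θ commute. If the smoothing noise w at z is coupled with cos θ w +
sin θ y at the rotated point, the two smoothed arguments are again a pair at angle θ. -/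
theorem noiseSens_noiseOp_le {f : EuclideanSpace ℝ (Fin d) → ℝ} (hf : Measurable f)
    (h : ∀ x, f x ∈ Set.Icc (0 : ℝ) 1) (s θ : ℝ) :
    noiseSens (noiseOp s f) θ ≤ noiseSens f θ := by
  set γ := gaussMeasure d
  set k : EuclideanSpace ℝ (Fin d) → EuclideanSpace ℝ (Fin d) → ℝ≥0∞ := fun x y =>
    ‖f x - f (Real.cos θ • x + Real.sin θ • y)‖ₑ with hk
  have hkm : Measurable (Function.uncurry k) := by
    simp only [hk, Function.uncurry_def]; fun_prop
  have hpt : ∀ z g, ‖noiseOp s f z - noiseOp s f (Real.cos θ • z + Real.sin θ • g)‖ₑ ≤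
      ∫⁻ w, ∫⁻ y, k (Real.cos s • z + Real.sin s • w) (Real.cos s • g + Real.sin s • y) ∂γ ∂γ := by
    intro z g
    set u : EuclideanSpace ℝ (Fin d) × EuclideanSpace ℝ (Fin d) → ℝ := fun q =>
      f (Real.cos s • z + Real.sin s • q.1) with hu
    set v : EuclideanSpace ℝ (Fin d) × EuclideanSpace ℝ (Fin d) → ℝ := fun q =>
      f (Real.cos s • (Real.cos θ • z + Real.sin θ • g) +
        Real.sin s • (Real.cos θ • q.1 + Real.sin θ • q.2)) with hv
    have hui : Integrable u (γ.prod γ) := integrable_of_mem_Icc (by fun_prop) fun _ => h _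
    have hvi : Integrable v (γ.prod γ) := integrable_of_mem_Icc (by fun_prop) fun _ => h _
    have e1 : noiseOp s f z = ∫ q, u q ∂(γ.prod γ) := by
      rw [integral_prod _ hui]
      simp [hu, noiseOp, γ]
    have e2 : noiseOp s f (Real.cos θ • z + Real.sin θ • g) = ∫ q, v q ∂(γ.prod γ) :=
      (integral_cos_add_sin θ (f := fun y => f (Real.cos s • (Real.cos θ • z + Real.sin θ • g) +
        Real.sin s • y)) (by fun_prop)).symm
    rw [e1, e2, ← integral_sub hui hvi]
    refine (enorm_integral_le_lintegral_enorm _).trans (le_of_eq ?_)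
    rw [lintegral_prod _ (by fun_prop)]
    refine lintegral_congr fun w => lintegral_congr fun y => ?_
    have e : Real.cos s • (Real.cos θ • z + Real.sin θ • g) +
        Real.sin s • (Real.cos θ • w + Real.sin θ • y) =
        Real.cos θ • (Real.cos s • z + Real.sin s • w) +
        Real.sin θ • (Real.cos s • g + Real.sin s • y) := by module
    simp only [hk, hu, hv, e]
  have hmarg : ∀ H : EuclideanSpace ℝ (Fin d) → ℝ≥0∞, Measurable H →
      ∫⁻ x, ∫⁻ y, H (Real.cos s • x + Real.sin s • y) ∂γ ∂γ = ∫⁻ x, H x ∂γ := by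
    intro H hH
    rw [← lintegral_cos_add_sin s hH, lintegral_prod _ (by fun_prop)]
  have hk4 : Measurable fun q : (EuclideanSpace ℝ (Fin d) × EuclideanSpace ℝ (Fin d)) ×
      (EuclideanSpace ℝ (Fin d) × EuclideanSpace ℝ (Fin d)) =>
      k (Real.cos s • q.1.1 + Real.sin s • q.2.1) (Real.cos s • q.1.2 + Real.sin s • q.2.2) := by
    simp only [hk]; fun_prop
  calc noiseSens (noiseOp s f) θ
      ≤ ∫⁻ p, ∫⁻ w, ∫⁻ y, k (Real.cos s • p.1 + Real.sin s • w)
          (Real.cos s • p.2 + Real.sin s • y) ∂γ ∂γ ∂(γ.prod γ) :=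
        lintegral_mono fun p => hpt p.1 p.2
    _ = ∫⁻ z, ∫⁻ g, ∫⁻ w, ∫⁻ y, k (Real.cos s • z + Real.sin s • w)
          (Real.cos s • g + Real.sin s • y) ∂γ ∂γ ∂γ ∂γ := by
        rw [lintegral_prod]
        refine Measurable.aemeasurable ?_
        refine Measurable.lintegral_prod_right' (f := fun q :
          (EuclideanSpace ℝ (Fin d) × EuclideanSpace ℝ (Fin d)) × EuclideanSpace ℝ (Fin d) =>
          ∫⁻ y, k (Real.cos s • q.1.1 + Real.sin s • q.2)
          (Real.cos s • q.1.2 + Real.sin s • y) ∂γ) ?_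
        refine Measurable.lintegral_prod_right' (f := fun q :
          ((EuclideanSpace ℝ (Fin d) × EuclideanSpace ℝ (Fin d)) × EuclideanSpace ℝ (Fin d)) ×
          EuclideanSpace ℝ (Fin d) => k (Real.cos s • q.1.1.1 + Real.sin s • q.1.2)
          (Real.cos s • q.1.1.2 + Real.sin s • q.2)) ?_
        simp only [hk]; fun_prop
    -- After this exchange the pairs (g, y) and (z, w) can each be merged into a single Gaussian
    -- vector.
    _ = ∫⁻ z, ∫⁻ w, ∫⁻ g, ∫⁻ y, k (Real.cos s • z + Real.sin s • w)
          (Real.cos s • g + Real.sin s • y) ∂γ ∂γ ∂γ ∂γ := by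
        refine lintegral_congr fun z => lintegral_lintegral_swap ?_
        refine Measurable.aemeasurable ?_
        refine Measurable.lintegral_prod_right' (f := fun q :
          (EuclideanSpace ℝ (Fin d) × EuclideanSpace ℝ (Fin d)) × EuclideanSpace ℝ (Fin d) =>
          k (Real.cos s • z + Real.sin s • q.1.2) (Real.cos s • q.1.1 + Real.sin s • q.2)) ?_
        simp only [hk]; fun_prop
    _ = ∫⁻ z, ∫⁻ w, ∫⁻ g, k (Real.cos s • z + Real.sin s • w) g ∂γ ∂γ ∂γ :=
        lintegral_congr fun z => lintegral_congr fun w =>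
          hmarg (fun g => k (Real.cos s • z + Real.sin s • w) g) (by simp only [hk]; fun_prop)
    _ = ∫⁻ z, ∫⁻ g, k z g ∂γ ∂γ :=
        hmarg (fun x => ∫⁻ g, k x g ∂γ) hkm.lintegral_prod_right
    _ = noiseSens f θ := by
        rw [noiseSens, lintegral_prod _ (by fun_prop)]

end Smoothing

/-! ### Linear functionals, translations, and smoothness of the noise operator -/

section CameronMartin

variable {d : ℕ}

theorem map_inner_gaussMeasure (k : EuclideanSpace ℝ (Fin d)) :
    (gaussMeasure d).map (fun w => inner ℝ k w) = gaussianReal 0 (‖k‖₊ ^ 2) := by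
  have h := IsGaussian.map_eq_gaussianReal (μ := gaussMeasure d) (innerSL ℝ k)
  rw [integral_strongDual_stdGaussian, variance_dual_stdGaussian, innerSL_apply_norm] at h
  have e : (‖k‖ ^ 2).toNNReal = ‖k‖₊ ^ 2 := by
    rw [Real.toNNReal_pow (norm_nonneg _), norm_toNNReal]
  rw [e] at h
  exact h

theorem map_inner_gaussMeasure_eq_map (k : EuclideanSpace ℝ (Fin d)) :
    (gaussMeasure d).map (fun w => inner ℝ k w) = (gaussianReal 0 1).map (‖k‖ * ·) := by
  rw [map_inner_gaussMeasure, gaussianReal_map_const_mul]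
  congr 1
  · simp
  · ext; simp

theorem integral_comp_inner_gaussMeasure (k : EuclideanSpace ℝ (Fin d)) {f : ℝ → ℝ}
    (hf : Measurable f) :
    ∫ w, f (inner ℝ k w) ∂gaussMeasure d = ∫ x, f x ∂gaussianReal 0 (‖k‖₊ ^ 2) := by
  rw [← map_inner_gaussMeasure, integral_map (by fun_prop) hf.aestronglyMeasurable]

theorem integrable_comp_inner_gaussMeasure (k : EuclideanSpace ℝ (Fin d)) {f : ℝ → ℝ}
    (hf : Integrable f (gaussianReal 0 (‖k‖₊ ^ 2))) :
    Integrable (fun w => f (inner ℝ k w)) (gaussMeasure d) := by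
  rw [← map_inner_gaussMeasure] at hf
  exact hf.comp_measurable (by fun_prop)

/-- The Cameron–Martin density of the translate of the Gaussian measure by `k`. -/
noncomputable def shiftDensity (k w : EuclideanSpace ℝ (Fin d)) : ℝ :=
  Real.exp (inner ℝ k w - ‖k‖ ^ 2 / 2)

theorem shiftDensity_nonneg (k w : EuclideanSpace ℝ (Fin d)) : 0 ≤ shiftDensity k w :=
  Real.exp_nonneg _

theorem measurable_shiftDensity (k : EuclideanSpace ℝ (Fin d)) : Measurable (shiftDensity k) := by
  unfold shiftDensity; fun_prop

theorem integrable_shiftDensity (k : EuclideanSpace ℝ (Fin d)) :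
    Integrable (shiftDensity k) (gaussMeasure d) := by
  have h : Integrable (fun x : ℝ => Real.exp (1 * x)) (gaussianReal 0 (‖k‖₊ ^ 2)) :=
    integrable_exp_mul_gaussianReal 1
  have := (integrable_comp_inner_gaussMeasure k h).mul_const (Real.exp (-(‖k‖ ^ 2 / 2)))
  refine this.congr (Eventually.of_forall fun w => ?_)
  simp only [shiftDensity, one_mul, sub_eq_add_neg, Real.exp_add]

/-- The integral factors over coordinates into one-dimensional values E exp(ζx) = exp(ζ²/2) at ζ = k
j + i t j. -/
theorem integral_cexp_gaussMeasure (k t : EuclideanSpace ℝ (Fin d)) :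
    ∫ w, Complex.exp ((inner ℝ k w : ℝ) + (inner ℝ w t : ℝ) * Complex.I) ∂gaussMeasure d =
      Complex.exp ((‖k‖ ^ 2 - ‖t‖ ^ 2) / 2 + (inner ℝ k t : ℝ) * Complex.I) := by
  rw [gaussMeasure, ← map_pi_eq_stdGaussian, integral_map (by fun_prop) (by fun_prop)]
  have h1 : ∀ x : Fin d → ℝ, Complex.exp ((inner ℝ k (WithLp.toLp 2 x) : ℝ) +
      (inner ℝ (WithLp.toLp 2 x) t : ℝ) * Complex.I) =
      ∏ j, Complex.exp (((k j : ℂ) + t j * Complex.I) * x j) := by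
    intro x
    rw [← Complex.exp_sum]
    congr 1
    simp only [PiLp.inner_apply, RCLike.inner_apply, conj_trivial]
    push_cast
    rw [Finset.sum_mul, ← Finset.sum_add_distrib]
    exact Finset.sum_congr rfl fun j _ => by ring
  simp_rw [h1]
  rw [integral_fintype_prod_eq_prod (fun j (x : ℝ) =>
    Complex.exp (((k j : ℂ) + t j * Complex.I) * x))]
  have h2 : ∀ j, ∫ x, Complex.exp (((k j : ℂ) + t j * Complex.I) * (x : ℝ)) ∂gaussianReal 0 1 =
      Complex.exp (((k j : ℂ) + t j * Complex.I) ^ 2 / 2) := by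
    intro j
    have := complexMGF_id_gaussianReal (μ := 0) (v := 1) ((k j : ℂ) + t j * Complex.I)
    simpa [complexMGF] using this
  simp_rw [h2]
  rw [← Complex.exp_sum]
  congr 1
  have hk : (‖k‖ : ℂ) ^ 2 = ∑ j, (k j : ℂ) ^ 2 := by
    have := EuclideanSpace.norm_sq_eq k
    simp only [Real.norm_eq_abs, sq_abs] at this
    exact_mod_cast this
  have ht : (‖t‖ : ℂ) ^ 2 = ∑ j, (t j : ℂ) ^ 2 := by
    have := EuclideanSpace.norm_sq_eq t
    simp only [Real.norm_eq_abs, sq_abs] at this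
    exact_mod_cast this
  rw [hk, ht]
  simp only [PiLp.inner_apply, RCLike.inner_apply, conj_trivial]
  push_cast
  rw [Finset.sum_mul, ← Finset.sum_sub_distrib, Finset.sum_div, ← Finset.sum_add_distrib]
  refine Finset.sum_congr rfl fun j _ => ?_
  linear_combination (t j : ℂ) ^ 2 / 2 * Complex.I_sq

/-- The Cameron–Martin formula. -/
theorem map_add_gaussMeasure (k : EuclideanSpace ℝ (Fin d)) :
    (gaussMeasure d).map (· + k) =
      (gaussMeasure d).withDensity fun w => ENNReal.ofReal (shiftDensity k w) := by
  have hfin : IsFiniteMeasure ((gaussMeasure d).withDensity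
      fun w => ENNReal.ofReal (shiftDensity k w)) :=
    isFiniteMeasure_withDensity_ofReal (integrable_shiftDensity k).2
  refine Measure.ext_of_charFun ?_
  ext t
  rw [charFun_apply, charFun_apply, integral_map (by fun_prop) (by fun_prop),
    integral_withDensity_eq_integral_toReal_smul (measurable_shiftDensity k).ennreal_ofReal
      (Eventually.of_forall fun _ => ENNReal.ofReal_lt_top)]
  -- Both characteristic functions reduce to the same Gaussian integral: with parameter 0 for the
  -- translate and k for the density.
  have h1 := integral_cexp_gaussMeasure 0 t
  have h2 := integral_cexp_gaussMeasure k t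
  have e1 : ∀ w, Complex.exp ((inner ℝ (w + k) t : ℝ) * Complex.I) =
      Complex.exp ((inner ℝ k t : ℝ) * Complex.I) *
      Complex.exp ((inner ℝ (0 : EuclideanSpace ℝ (Fin d)) w : ℝ) +
        (inner ℝ w t : ℝ) * Complex.I) := by
    intro w
    rw [← Complex.exp_add, inner_add_left, inner_zero_left]
    congr 1
    push_cast
    ring
  have e2 : ∀ w, (ENNReal.ofReal (shiftDensity k w)).toReal •
      Complex.exp ((inner ℝ w t : ℝ) * Complex.I) = Complex.exp (-(‖k‖ : ℂ) ^ 2 / 2) *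
      Complex.exp ((inner ℝ k w : ℝ) + (inner ℝ w t : ℝ) * Complex.I) := by
    intro w
    rw [ENNReal.toReal_ofReal (shiftDensity_nonneg k w), shiftDensity, Complex.real_smul,
      Complex.ofReal_exp, ← Complex.exp_add, ← Complex.exp_add]
    congr 1
    push_cast
    ring
  simp_rw [e1, e2]
  rw [integral_const_mul, integral_const_mul, h1, h2, ← Complex.exp_add, ← Complex.exp_add]
  congr 1
  simp only [norm_zero, inner_zero_left]
  push_cast
  ring

theorem integral_comp_add_gaussMeasure (k : EuclideanSpace ℝ (Fin d))
    {u : EuclideanSpace ℝ (Fin d) → ℝ} (hu : Measurable u) :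
    ∫ w, u (w + k) ∂gaussMeasure d = ∫ w, u w * shiftDensity k w ∂gaussMeasure d := by
  rw [← integral_map (φ := fun w => w + k) (by fun_prop) hu.aestronglyMeasurable,
    map_add_gaussMeasure, integral_withDensity_eq_integral_toReal_smul
      (measurable_shiftDensity k).ennreal_ofReal
      (Eventually.of_forall fun _ => ENNReal.ofReal_lt_top)]
  refine integral_congr_ae (Eventually.of_forall fun w => ?_)
  change (ENNReal.ofReal (shiftDensity k w)).toReal • u w = u w * shiftDensity k w
  rw [ENNReal.toReal_ofReal (shiftDensity_nonneg k w), smul_eq_mul, mul_comm]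

/-- The exponential is the Hermite generating series for variance v; without its terms of degree 0
and 1 its squared norm is the sum of vⁿ/n! over n ≥ 2. Here the square is expanded and each moment
evaluated. -/
theorem integrable_exp_error_sq (v : NNReal) :
    Integrable (fun x => (Real.exp (x - v / 2) - 1 - x) ^ 2) (gaussianReal 0 v) ∧
      ∫ x, (Real.exp (x - v / 2) - 1 - x) ^ 2 ∂gaussianReal 0 v = Real.exp v - 1 - v := by
  have hset : ∀ t : ℝ, t ∈ interior (integrableExpSet id (gaussianReal 0 v)) := by
    simp [integrableExpSet_id_gaussianReal]
  have i1 : Integrable (fun x => Real.exp (2 * x)) (gaussianReal 0 v) :=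
    integrable_exp_mul_gaussianReal 2
  have i2 : Integrable (fun x => Real.exp (1 * x)) (gaussianReal 0 v) :=
    integrable_exp_mul_gaussianReal 1
  have i3 : Integrable (fun x : ℝ => x * Real.exp (1 * x)) (gaussianReal 0 v) := by
    simpa using integrable_pow_mul_exp_of_mem_interior_integrableExpSet (hset 1) 1
  have i4 : Integrable (fun x : ℝ => x ^ 2) (gaussianReal 0 v) :=
    (memLp_id_gaussianReal 2).integrable_sq
  have i5 : Integrable (fun x : ℝ => x) (gaussianReal 0 v) :=
    memLp_one_iff_integrable.1 (memLp_id_gaussianReal 1)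
  have m1 : ∫ x, Real.exp (2 * x) ∂gaussianReal 0 v = Real.exp (2 * v) := by
    have := congrFun (mgf_id_gaussianReal (μ := 0) (v := v)) 2
    simp only [mgf, id] at this
    rw [this]; congr 1; ring
  have m2 : ∫ x, Real.exp (1 * x) ∂gaussianReal 0 v = Real.exp (v / 2) := by
    have := congrFun (mgf_id_gaussianReal (μ := 0) (v := v)) 1
    simp only [mgf, id] at this
    rw [this]; congr 1; ring
  have m3 : ∫ x, x * Real.exp (1 * x) ∂gaussianReal 0 v = v * Real.exp (v / 2) := by
    have h1 := (hasDerivAt_mgf (hset 1)).deriv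
    rw [mgf_id_gaussianReal] at h1
    have h2 : HasDerivAt (fun t : ℝ => Real.exp (0 * t + v * t ^ 2 / 2)) (v * Real.exp (v / 2)) 1 := by
      have h3 : HasDerivAt (fun t : ℝ => 0 * t + v * t ^ 2 / 2) (v : ℝ) 1 := by
        refine HasDerivAt.congr_deriv (((hasDerivAt_id (1 : ℝ)).const_mul 0).add
          (((hasDerivAt_pow 2 (1 : ℝ)).const_mul (v : ℝ)).div_const 2)) ?_
        simp
      refine HasDerivAt.congr_deriv h3.exp ?_
      simp [mul_comm]
    rw [h2.deriv] at h1
    simpa using h1.symm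
  have m4 : ∫ x, x ^ 2 ∂gaussianReal 0 v = v := by
    have := variance_fun_id_gaussianReal (μ := 0) (v := v)
    rw [variance_eq_integral (by fun_prop), integral_id_gaussianReal] at this
    simpa using this
  have m5 : ∫ x, 2 * x ∂gaussianReal 0 v = 0 := by
    rw [integral_const_mul, integral_id_gaussianReal, mul_zero]
  have hexp : ∀ x : ℝ, (Real.exp (x - v / 2) - 1 - x) ^ 2 =
      (Real.exp (-v) * Real.exp (2 * x) + (-2 * Real.exp (-v / 2)) * Real.exp (1 * x)) +
      ((-2 * Real.exp (-v / 2)) * (x * Real.exp (1 * x)) + x ^ 2) + (2 * x + 1) := by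
    intro x
    have e1 : Real.exp (x - v / 2) = Real.exp (-v / 2) * Real.exp x := by
      rw [← Real.exp_add]; congr 1; ring
    have e2 : Real.exp (-v) = Real.exp (-v / 2) ^ 2 := by
      rw [← Real.exp_nat_mul]; congr 1; push_cast; ring
    have e3 : Real.exp (2 * x) = Real.exp x ^ 2 := by
      rw [← Real.exp_nat_mul]; norm_num
    rw [e1, e2, e3, one_mul]
    ring
  simp_rw [hexp]
  have j1 : Integrable (fun x => Real.exp (-v) * Real.exp (2 * x) +
      (-2 * Real.exp (-v / 2)) * Real.exp (1 * x)) (gaussianReal 0 v) := (i1.const_mul (Real.exp (-v))).add (i2.const_mul (-2 * Real.exp (-v / 2)))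
  have j2 : Integrable (fun x => (-2 * Real.exp (-v / 2)) * (x * Real.exp (1 * x)) + x ^ 2)
      (gaussianReal 0 v) := (i3.const_mul (-2 * Real.exp (-v / 2))).add i4
  have j3 : Integrable (fun x : ℝ => 2 * x + 1) (gaussianReal 0 v) := (i5.const_mul 2).add (integrable_const (μ := gaussianReal 0 v) (1 : ℝ))
  have j12 : Integrable (fun x => (Real.exp (-v) * Real.exp (2 * x) +
      (-2 * Real.exp (-v / 2)) * Real.exp (1 * x)) +
      ((-2 * Real.exp (-v / 2)) * (x * Real.exp (1 * x)) + x ^ 2)) (gaussianReal 0 v) := j1.add j2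
  refine ⟨j12.add j3, ?_⟩
  rw [integral_add j12 j3, integral_add j1 j2,
    integral_add (i1.const_mul _) (i2.const_mul _), integral_add (i3.const_mul _) i4,
    integral_add (i5.const_mul 2) (integrable_const _)]
  rw [m5]
  simp only [integral_const_mul, m1, m2, m3, m4, integral_const, probReal_univ, one_smul]
  have e1 : Real.exp (-v) * Real.exp (2 * v) = Real.exp v := by
    rw [← Real.exp_add]; congr 1; ring
  have e2 : Real.exp (-v / 2) * Real.exp (v / 2) = 1 := by
    rw [← Real.exp_add]; simp [neg_div]
  linear_combination e1 - (2 + 2 * v) * e2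

theorem integrable_shiftDensity_error (k : EuclideanSpace ℝ (Fin d)) :
    Integrable (fun w => shiftDensity k w - 1 - inner ℝ k w) (gaussMeasure d) :=
  ((integrable_shiftDensity k).sub (integrable_const 1)).sub
    (integrable_comp_inner_gaussMeasure k (f := fun x => x)
      (memLp_one_iff_integrable.1 (memLp_id_gaussianReal 1)))

theorem integral_abs_shiftDensity_error_le {k : EuclideanSpace ℝ (Fin d)} (hk : ‖k‖ ≤ 1) :
    ∫ w, |shiftDensity k w - 1 - inner ℝ k w| ∂gaussMeasure d ≤ ‖k‖ ^ 2 := by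
  rcases eq_or_ne k 0 with rfl | hk0
  · simp [shiftDensity]
  have hpos : 0 < ‖k‖ ^ 2 := by have := norm_pos_iff.2 hk0; positivity
  obtain ⟨hi, hv⟩ := integrable_exp_error_sq (‖k‖₊ ^ 2)
  push_cast at hi hv
  have hi' := integrable_comp_inner_gaussMeasure k hi
  have hv' := integral_comp_inner_gaussMeasure k
    (f := fun x => (Real.exp (x - ‖k‖ ^ 2 / 2) - 1 - x) ^ 2) (by fun_prop)
  rw [hv] at hv'
  have hle : Real.exp (‖k‖ ^ 2) - 1 - ‖k‖ ^ 2 ≤ (‖k‖ ^ 2) ^ 2 := by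
    have h1 : |‖k‖ ^ 2| ≤ 1 := by
      rw [abs_of_pos hpos]; exact pow_le_one₀ (norm_nonneg _) hk
    exact (le_abs_self _).trans (Real.abs_exp_sub_one_sub_id_le h1)
  -- This is |y| ≤ y²/(2κ) + κ/2 with κ = ‖k‖², the scale for which both terms contribute at most
  -- κ/2 after integration.
  have hpt : ∀ w, |shiftDensity k w - 1 - inner ℝ k w| ≤
      (2 * ‖k‖ ^ 2)⁻¹ * (Real.exp (inner ℝ k w - ‖k‖ ^ 2 / 2) - 1 - inner ℝ k w) ^ 2 +
        ‖k‖ ^ 2 / 2 := by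
    intro w
    change |Real.exp (inner ℝ k w - ‖k‖ ^ 2 / 2) - 1 - inner ℝ k w| ≤ _
    set y := Real.exp (inner ℝ k w - ‖k‖ ^ 2 / 2) - 1 - inner ℝ k w
    rw [← sq_abs y]
    have e : (2 * ‖k‖ ^ 2)⁻¹ * |y| ^ 2 + ‖k‖ ^ 2 / 2 - |y| =
        (2 * ‖k‖ ^ 2)⁻¹ * (|y| - ‖k‖ ^ 2) ^ 2 := by field_simp; ring
    have : 0 ≤ (2 * ‖k‖ ^ 2)⁻¹ * (|y| - ‖k‖ ^ 2) ^ 2 := by positivity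
    linarith
  calc _ ≤ ∫ w, ((2 * ‖k‖ ^ 2)⁻¹ * (Real.exp (inner ℝ k w - ‖k‖ ^ 2 / 2) - 1 - inner ℝ k w) ^ 2 +
        ‖k‖ ^ 2 / 2) ∂gaussMeasure d :=
        integral_mono (integrable_shiftDensity_error k).abs
          ((hi'.const_mul _).add (integrable_const _)) hpt
    _ = (2 * ‖k‖ ^ 2)⁻¹ * (Real.exp (‖k‖ ^ 2) - 1 - ‖k‖ ^ 2) + ‖k‖ ^ 2 / 2 := by
        rw [integral_add (hi'.const_mul _) (integrable_const _), integral_const_mul, hv']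
        simp
    _ ≤ (2 * ‖k‖ ^ 2)⁻¹ * (‖k‖ ^ 2) ^ 2 + ‖k‖ ^ 2 / 2 := by gcongr
    _ = ‖k‖ ^ 2 := by field_simp; ring

/-- Smoothness of the noise operator. -/
theorem hasUniformGradient_noiseOp {f : EuclideanSpace ℝ (Fin d) → ℝ} (hf : Measurable f)
    (h : ∀ x, f x ∈ Set.Icc (0 : ℝ) 1) {s : ℝ} (hs : 0 < Real.sin s) :
    HasUniformGradient (noiseOp s f) fun x => (Real.cos s / Real.sin s) •
      ∫ w, f (Real.cos s • x + Real.sin s • w) • w ∂gaussMeasure d := by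
  set c := Real.cos s
  set σ := Real.sin s
  set a := c / σ with ha
  -- Moving x by y amounts to moving w by k = a • y, so Cameron–Martin gives the error ‖k‖² =
  -- a²‖y‖². The radius ensures ‖k‖ ≤ 1, and the added 1 covers a = 0.
  refine ⟨a ^ 2, 1 / (|a| + 1), by positivity, by positivity, fun x y hy => ?_⟩
  set k := a • y with hk
  have hkn : ‖k‖ ≤ 1 := by
    rw [hk, norm_smul, Real.norm_eq_abs]
    calc |a| * ‖y‖ ≤ (|a| + 1) * (1 / (|a| + 1)) := by gcongr; linarith
      _ = 1 := by field_simp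
  set u : EuclideanSpace ℝ (Fin d) → ℝ := fun w => f (c • x + σ • w) with hu
  have hum : Measurable u := by fun_prop
  have hub : ∀ w, ‖u w‖ ≤ 1 := fun w => by
    rw [Real.norm_of_nonneg (h _).1]; exact (h _).2
  have e1 : noiseOp s f (x + y) = ∫ w, u w * shiftDensity k w ∂gaussMeasure d := by
    rw [← integral_comp_add_gaussMeasure k hum, noiseOp]
    refine integral_congr_ae (Eventually.of_forall fun w => ?_)
    simp only [hu, hk]
    congr 1
    rw [smul_add, smul_add, smul_smul, show σ * a = c by rw [ha]; field_simp]
    change c • x + c • y + σ • w = _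
    abel
  have hid : Integrable (fun w : EuclideanSpace ℝ (Fin d) => w) (gaussMeasure d) :=
    IsGaussian.integrable_fun_id
  have hint : Integrable (fun w => u w • w) (gaussMeasure d) :=
    hid.bdd_smul 1 hum.aestronglyMeasurable (Eventually.of_forall hub)
  have e2 : inner ℝ (a • ∫ w, u w • w ∂gaussMeasure d) y =
      ∫ w, u w * inner ℝ k w ∂gaussMeasure d := by
    rw [inner_smul_left, real_inner_comm, ← integral_inner hint, hk]
    simp only [conj_trivial]
    rw [← integral_const_mul]
    refine integral_congr_ae (Eventually.of_forall fun w => ?_)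
    simp only [inner_smul_left, inner_smul_right, conj_trivial]
    ring
  have i1 : Integrable (fun w => u w * shiftDensity k w) (gaussMeasure d) :=
    (integrable_shiftDensity k).bdd_mul hum.aestronglyMeasurable (Eventually.of_forall hub)
  have i2 : Integrable u (gaussMeasure d) :=
    integrable_of_mem_Icc hum fun w => h _
  have i3 : Integrable (fun w => u w * inner ℝ k w) (gaussMeasure d) :=
    (hid.const_inner k).bdd_mul hum.aestronglyMeasurable (Eventually.of_forall hub)
  have e3 : noiseOp s f (x + y) - noiseOp s f x - inner ℝ (a • ∫ w, u w • w ∂gaussMeasure d) y =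
      ∫ w, u w * (shiftDensity k w - 1 - inner ℝ k w) ∂gaussMeasure d := by
    have i12 : Integrable (fun w => u w * shiftDensity k w - u w) (gaussMeasure d) := i1.sub i2
    rw [e1, e2, show noiseOp s f x = ∫ w, u w ∂gaussMeasure d from rfl, ← integral_sub i1 i2,
      ← integral_sub i12 i3]
    refine integral_congr_ae (Eventually.of_forall fun w => ?_)
    ring
  rw [e3]
  calc |∫ w, u w * (shiftDensity k w - 1 - inner ℝ k w) ∂gaussMeasure d|
      ≤ ∫ w, |shiftDensity k w - 1 - inner ℝ k w| ∂gaussMeasure d := by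
        rw [← Real.norm_eq_abs]
        refine norm_integral_le_of_norm_le (integrable_shiftDensity_error k).abs
          (Eventually.of_forall fun w => ?_)
        rw [norm_mul, Real.norm_eq_abs (_ - _)]
        exact mul_le_of_le_one_left (abs_nonneg _) (hub w)
    _ ≤ ‖k‖ ^ 2 := integral_abs_shiftDensity_error_le hkn
    _ = a ^ 2 * ‖y‖ ^ 2 := by rw [hk, norm_smul, mul_pow, Real.norm_eq_abs, sq_abs]

end CameronMartin

/-! ### The isoperimetric lower bound -/

theorem gaussianPDFReal_zero : gaussianPDFReal 0 1 0 = (√(2 * Real.pi))⁻¹ := by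
  simp [gaussianPDFReal_zero_one]

theorem tendsto_gaussianPDFReal_atTop : Tendsto (gaussianPDFReal 0 1) atTop (𝓝 0) := by
  have := tendsto_gaussianPDFReal_atBot.comp tendsto_neg_atTop_atBot
  refine this.congr fun x => ?_
  simp [gaussianPDFReal_neg]

/-- By symmetry the integral is twice that of xφ over the positive half-line, where -φ is a
primitive; the value is 2φ(0). -/
theorem integral_abs_gaussianReal : ∫ x, |x| ∂gaussianReal 0 1 = √(2 / Real.pi) := by
  rw [integral_gaussianReal_eq_integral_smul one_ne_zero]
  have h1 : ∀ x : ℝ, gaussianPDFReal 0 1 x • |x| =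
      (fun y => y * gaussianPDFReal 0 1 y) |x| := by
    intro x
    simp only [smul_eq_mul]
    rw [mul_comm]
    congr 1
    simp [gaussianPDFReal_zero_one]
  rw [integral_congr_ae (Eventually.of_forall h1),
    integral_comp_abs (f := fun y => y * gaussianPDFReal 0 1 y)]
  have h2 : ∫ x in Set.Ioi (0 : ℝ), x * gaussianPDFReal 0 1 x = 0 - -gaussianPDFReal 0 1 0 := by
    refine integral_Ioi_of_hasDerivAt_of_nonneg' (g := fun x => -gaussianPDFReal 0 1 x)
      (fun x _ => ?_) (fun x hx => mul_nonneg (le_of_lt hx) (gaussianPDFReal_nonneg 0 1 x)) ?_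
    · refine HasDerivAt.congr_deriv (hasDerivAt_gaussianPDFReal x).neg ?_
      ring
    · simpa using tendsto_gaussianPDFReal_atTop.neg
  rw [h2, gaussianPDFReal_zero, zero_sub, neg_neg]
  rw [eq_comm, Real.sqrt_eq_iff_mul_self_eq_of_pos (by positivity)]
  have h3 := Real.mul_self_sqrt (by positivity : 0 ≤ 2 * Real.pi)
  calc 2 * (√(2 * Real.pi))⁻¹ * (2 * (√(2 * Real.pi))⁻¹)
      = 4 * (√(2 * Real.pi) * √(2 * Real.pi))⁻¹ := by rw [mul_inv]; ring
    _ = 2 / Real.pi := by rw [h3]; field_simp; norm_num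

theorem lintegral_enorm_gaussianReal :
    ∫⁻ x, ‖x‖ₑ ∂gaussianReal 0 1 = ENNReal.ofReal √(2 / Real.pi) := by
  rw [← integral_abs_gaussianReal]
  exact (ofReal_integral_norm_eq_lintegral_enorm (f := fun x : ℝ => x)
    (memLp_one_iff_integrable.1 (memLp_id_gaussianReal 1))).symm

section LowerBound

variable {d : ℕ}

theorem lintegral_enorm_inner_gaussMeasure (v : EuclideanSpace ℝ (Fin d)) :
    ∫⁻ g, ‖(inner ℝ v g : ℝ)‖ₑ ∂gaussMeasure d = ENNReal.ofReal √(2 / Real.pi) * ‖v‖ₑ := by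
  rw [← lintegral_map (f := fun x : ℝ => ‖x‖ₑ) (g := fun g => (inner ℝ v g : ℝ)) (by fun_prop)
    (by fun_prop), map_inner_gaussMeasure_eq_map, lintegral_map (by fun_prop) (by fun_prop)]
  simp_rw [enorm_mul, enorm_norm]
  rw [lintegral_const_mul _ (by fun_prop), lintegral_enorm_gaussianReal, mul_comm]

/-- Along the rotation the difference quotient of F converges pointwise to |⟨G(z), g⟩|, whose mean
over g is √(2/π)‖G(z)‖. Fatou's lemma then needs only the bound on the quotients. -/
theorem lintegral_enorm_gradient_le {F : EuclideanSpace ℝ (Fin d) → ℝ}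
    {G : EuclideanSpace ℝ (Fin d) → EuclideanSpace ℝ (Fin d)} (h : HasUniformGradient F G)
    {L : ℝ≥0∞} (hL : ∀ θ, 0 < θ → noiseSens F θ ≤ L * ENNReal.ofReal θ) :
    ENNReal.ofReal √(2 / Real.pi) * ∫⁻ x, ‖G x‖ₑ ∂gaussMeasure d ≤ L := by
  have hF := h.continuous_left
  have hG := h.continuous_right
  set μ := (gaussMeasure d).prod (gaussMeasure d)
  set q : ℝ → EuclideanSpace ℝ (Fin d) × EuclideanSpace ℝ (Fin d) → ℝ≥0∞ := fun θ p =>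
    ‖F p.1 - F (Real.cos θ • p.1 + Real.sin θ • p.2)‖ₑ / ENNReal.ofReal θ with hq
  have hqm : ∀ θ, Measurable (q θ) := fun θ => by
    simp only [hq]
    have : Measurable fun p : EuclideanSpace ℝ (Fin d) × EuclideanSpace ℝ (Fin d) =>
      ‖F p.1 - F (Real.cos θ • p.1 + Real.sin θ • p.2)‖ₑ := by fun_prop
    exact this.div_const _
  have hlim : ∀ p, Tendsto (fun θ => q θ p) (𝓝[>] 0) (𝓝 ‖(inner ℝ (G p.1) p.2 : ℝ)‖ₑ) := by
    intro p
    have hc : HasDerivAt (fun θ : ℝ => Real.cos θ • p.1 + Real.sin θ • p.2) p.2 0 := by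
      refine HasDerivAt.congr_deriv (((Real.hasDerivAt_cos 0).smul_const p.1).add
        ((Real.hasDerivAt_sin 0).smul_const p.2)) ?_
      simp
    have h0 : Real.cos 0 • p.1 + Real.sin 0 • p.2 = p.1 := by simp
    have hFp : HasFDerivAt F (innerSL ℝ (G p.1)) (Real.cos 0 • p.1 + Real.sin 0 • p.2) := by
      rw [h0]; exact h.hasFDerivAt p.1
    have hd := hFp.comp_hasDerivAt (0 : ℝ) hc
    rw [hasDerivAt_iff_tendsto_slope] at hd
    have hd2 := (hd.mono_left (nhdsWithin_mono 0 fun x (hx : 0 < x) => ne_of_gt hx)).enorm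
    refine hd2.congr' ?_
    filter_upwards [self_mem_nhdsWithin] with θ hθ
    have hθ' : 0 < θ := hθ
    rw [slope_def_field, hq]
    simp only [Function.comp_apply, h0, sub_zero]
    rw [← ofReal_norm, ← ofReal_norm, norm_div, Real.norm_of_nonneg hθ'.le,
      ENNReal.ofReal_div_of_pos hθ', norm_sub_rev]
  calc ENNReal.ofReal √(2 / Real.pi) * ∫⁻ x, ‖G x‖ₑ ∂gaussMeasure d
      = ∫⁻ p, ‖(inner ℝ (G p.1) p.2 : ℝ)‖ₑ ∂μ := by
        rw [lintegral_prod _ (by fun_prop), ← lintegral_const_mul _ (by fun_prop)]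
        exact lintegral_congr fun x => (lintegral_enorm_inner_gaussMeasure _).symm
    _ = ∫⁻ p, liminf (fun θ => q θ p) (𝓝[>] 0) ∂μ :=
        lintegral_congr fun p => (hlim p).liminf_eq.symm
    _ ≤ liminf (fun θ => ∫⁻ p, q θ p ∂μ) (𝓝[>] 0) := lintegral_liminf_le hqm
    _ ≤ L := by
        refine liminf_le_of_frequently_le' (Eventually.frequently ?_)
        filter_upwards [self_mem_nhdsWithin] with θ hθ
        have hθ' : 0 < θ := hθ
        simp only [hq, div_eq_mul_inv]
        rw [lintegral_mul_const _ (by fun_prop), ← div_eq_mul_inv,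
          ENNReal.div_le_iff (by simpa using hθ') ENNReal.ofReal_ne_top]
        exact hL θ hθ'

theorem sq_integral_le {Ω : Type*} [MeasurableSpace Ω] {μ : Measure Ω} [IsProbabilityMeasure μ]
    {f : Ω → ℝ} (hf : MemLp f 2 μ) : (∫ x, f x ∂μ) ^ 2 ≤ ∫ x, f x ^ 2 ∂μ := by
  have h := variance_nonneg f μ
  rw [variance_eq_sub hf] at h
  simpa using h

/-- As f takes only the values 0 and 1, I(F)² ≤ F(1 - F) ≤ |f - F|; Cauchy–Schwarz passes from I(F)
to its square. -/
theorem integral_gaussIso_noiseOp_le {f : EuclideanSpace ℝ (Fin d) → ℝ} (hf : Measurable f)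
    (h : ∀ x, f x = 0 ∨ f x = 1) (s : ℝ) :
    ∫ x, gaussIso (noiseOp s f x) ∂gaussMeasure d ≤ √(noiseSens f s).toReal := by
  have h01 : ∀ x, f x ∈ Set.Icc (0 : ℝ) 1 := fun x => by rcases h x with h | h <;> simp [h]
  have hFm := measurable_noiseOp hf s
  have hF := noiseOp_mem_Icc hf h01 s
  set F := noiseOp s f
  have hIm : Measurable fun x => gaussIso (F x) := continuous_gaussIso.measurable.comp hFm
  have hpt : ∀ x, gaussIso (F x) ^ 2 ≤ |f x - F x| := by
    intro x
    refine (gaussIso_sq_le (hF x)).trans ?_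
    have h0 := (hF x).1
    have h1 := (hF x).2
    rcases h x with e | e <;> rw [e]
    · rw [zero_sub, abs_neg, abs_of_nonneg h0]; nlinarith
    · rw [abs_of_nonneg (by linarith)]; nlinarith
  have hfi : Integrable (fun x => |f x - F x|) (gaussMeasure d) :=
    ((integrable_of_mem_Icc hf h01).sub (integrable_of_mem_Icc hFm hF)).abs
  apply Real.le_sqrt_of_sq_le
  have hmem : MemLp (fun x => gaussIso (F x)) 2 (gaussMeasure d) :=
    MemLp.of_bound hIm.aestronglyMeasurable 1 (Eventually.of_forall fun x => by
      rw [Real.norm_of_nonneg (gaussIso_nonneg _)]; exact gaussIso_le_one _)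
  refine (sq_integral_le hmem).trans ?_
  refine (integral_mono hmem.integrable_sq hfi hpt).trans ?_
  rw [integral_eq_lintegral_of_nonneg_ae (Eventually.of_forall fun x => abs_nonneg _)
    hfi.aestronglyMeasurable]
  refine ENNReal.toReal_mono ?_ ?_
  · refine ne_top_of_le_ne_top ENNReal.one_ne_top ?_
    calc noiseSens f s ≤ ∫⁻ _, 1 ∂((gaussMeasure d).prod (gaussMeasure d)) := by
          refine lintegral_mono fun p => ?_
          rcases h p.1 with e1 | e1 <;>
          rcases h (Real.cos s • p.1 + Real.sin s • p.2) with e2 | e2 <;> simp [e1, e2]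
      _ = 1 := by simp
  · refine le_trans (le_of_eq (lintegral_congr fun x => ?_)) (lintegral_sub_noiseOp_le hf h01 s)
    exact (Real.enorm_eq_ofReal_abs _).symm

/-- Bobkov's inequality for the smoothed function is split by √(a² + b²) ≤ a + b. The first part is
small with the noise; the second is the gradient term, controlled by L because smoothing does not
increase sensitivity. -/
theorem gaussIso_le_noiseSens {f : EuclideanSpace ℝ (Fin d) → ℝ} (hf : Measurable f)
    (h : ∀ x, f x = 0 ∨ f x = 1) {L : ℝ≥0∞}
    (hL : ∀ θ, 0 < θ → noiseSens f θ ≤ L * ENNReal.ofReal θ) {s : ℝ} (hs : 0 < Real.sin s) :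
    ENNReal.ofReal (gaussIso (∫ x, f x ∂gaussMeasure d)) ≤
      ENNReal.ofReal √(noiseSens f s).toReal + ENNReal.ofReal √(Real.pi / 2) * L := by
  have h01 : ∀ x, f x ∈ Set.Icc (0 : ℝ) 1 := fun x => by rcases h x with h | h <;> simp [h]
  have hgrad := hasUniformGradient_noiseOp hf h01 hs
  have hF := noiseOp_mem_Icc hf h01 s
  have hB := bobkov_gaussMeasure hgrad hF
  have hFat := lintegral_enorm_gradient_le hgrad fun θ hθ =>
    (noiseSens_noiseOp_le hf h01 s θ).trans (hL θ hθ)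
  have hFc := hgrad.continuous_left
  have hGc := hgrad.continuous_right
  obtain ⟨M, hM⟩ := hgrad.exists_norm_le hF
  rw [integral_noiseOp hf h01] at hB
  have hI := integral_gaussIso_noiseOp_le hf h s
  set F := noiseOp s f
  set G : EuclideanSpace ℝ (Fin d) → EuclideanSpace ℝ (Fin d) := fun x =>
    (Real.cos s / Real.sin s) •
      ∫ w, f (Real.cos s • x + Real.sin s • w) • w ∂gaussMeasure d
  have hIc := continuous_gaussIso.comp hFc
  have i1 : Integrable (fun x => gaussIso (F x)) (gaussMeasure d) :=
    integrable_of_mem_Icc hIc.measurable fun x => ⟨gaussIso_nonneg _, gaussIso_le_one _⟩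
  have i3 : Integrable G (gaussMeasure d) :=
    Integrable.of_bound hGc.aestronglyMeasurable M (Eventually.of_forall hM)
  have i2 := i3.norm
  have hle : gaussIso (∫ x, f x ∂gaussMeasure d) ≤
      √(noiseSens f s).toReal + ∫ x, ‖G x‖ ∂gaussMeasure d := by
    refine hB.trans ?_
    refine le_trans ?_ (add_le_add_left hI _)
    rw [← integral_add i1 i2]
    refine integral_mono_of_nonneg (Eventually.of_forall fun x => Real.sqrt_nonneg _) (i1.add i2)
      (Eventually.of_forall fun x => ?_)
    have h1 := gaussIso_nonneg (F x)
    have h2 := norm_nonneg (G x)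
    refine Real.sqrt_le_iff.2 ⟨add_nonneg h1 h2, ?_⟩
    change gaussIso (F x) ^ 2 + ‖G x‖ ^ 2 ≤ (gaussIso (F x) + ‖G x‖) ^ 2
    nlinarith [mul_nonneg h1 h2]
  refine (ENNReal.ofReal_le_ofReal hle).trans ?_
  rw [ENNReal.ofReal_add (Real.sqrt_nonneg _) (integral_nonneg fun x => norm_nonneg _)]
  gcongr
  rw [ofReal_integral_norm_eq_lintegral_enorm i3]
  calc ∫⁻ x, ‖G x‖ₑ ∂gaussMeasure d = ENNReal.ofReal √(Real.pi / 2) *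
        (ENNReal.ofReal √(2 / Real.pi) * ∫⁻ x, ‖G x‖ₑ ∂gaussMeasure d) := by
        rw [← mul_assoc, ← ENNReal.ofReal_mul (Real.sqrt_nonneg _),
          ← Real.sqrt_mul (by positivity)]
        have : Real.pi / 2 * (2 / Real.pi) = 1 := by field_simp
        rw [this]; simp
    _ ≤ _ := by gcongr

/-- The Gaussian isoperimetric inequality. -/
theorem gaussIso_le_gaussSurf {A : Set (EuclideanSpace ℝ (Fin d))} (hA : MeasurableSet A) :
    ENNReal.ofReal (gaussIso ((gaussMeasure d).real A)) ≤ gaussSurf A := by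
  have hm : Measurable (A.indicator fun _ => (1 : ℝ)) := measurable_const.indicator hA
  have hi : Integrable (A.indicator fun _ => (1 : ℝ)) (gaussMeasure d) :=
    (integrable_const 1).indicator hA
  have h01 : ∀ x, A.indicator (fun _ => (1 : ℝ)) x = 0 ∨ A.indicator (fun _ => (1 : ℝ)) x = 1 := by
    classical
    intro x
    rw [Set.indicator_apply]
    split_ifs <;> simp
  have e : (gaussMeasure d).real A = ∫ x, A.indicator (fun _ => (1 : ℝ)) x ∂gaussMeasure d := by
    rw [integral_indicator_const _ hA]; simp
  rw [e]
  -- As the smoothing angle s tends to 0, only the derivative term survives.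
  have hlim : Tendsto (fun s => ENNReal.ofReal √(noiseSens (A.indicator fun _ => (1 : ℝ)) s).toReal +
      ENNReal.ofReal √(Real.pi / 2) * rotSensDeriv A) (𝓝[>] 0) (𝓝 (0 + gaussSurf A)) := by
    refine Tendsto.add ?_ tendsto_const_nhds
    have h1 := (ENNReal.tendsto_toReal ENNReal.zero_ne_top).comp
      ((tendsto_noiseSens hm hi).mono_left (nhdsWithin_le_nhds (s := Set.Ioi 0)))
    have h2 := ENNReal.tendsto_ofReal ((Real.continuous_sqrt.tendsto _).comp h1)
    simpa using h2
  rw [zero_add] at hlim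
  refine ge_of_tendsto hlim ?_
  filter_upwards [Ioo_mem_nhdsGT Real.pi_pos] with s hs
  exact gaussIso_le_noiseSens hm h01 (fun θ hθ => noiseSens_le_rotSensDeriv_mul hA hθ)
    (Real.sin_pos_of_mem_Ioo hs)

end LowerBound

/-! ### Halfspaces -/

section Congr

variable {d : ℕ}

theorem rotSensQuot_congr {A B : Set (EuclideanSpace ℝ (Fin d))} (h : A =ᵐ[gaussMeasure d] B) :
    rotSensQuot A = rotSensQuot B := by
  ext δ
  rw [rotSensQuot, rotSensQuot, rotSens_congr h]

theorem rotSensDeriv_congr {A B : Set (EuclideanSpace ℝ (Fin d))} (h : A =ᵐ[gaussMeasure d] B) :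
    rotSensDeriv A = rotSensDeriv B := by
  rw [rotSensDeriv, rotSensDeriv, rotSensQuot_congr h]

theorem gaussSurf_congr {A B : Set (EuclideanSpace ℝ (Fin d))} (h : A =ᵐ[gaussMeasure d] B) :
    gaussSurf A = gaussSurf B := by
  rw [gaussSurf, gaussSurf, rotSensDeriv_congr h]

theorem gaussSurf_eq_zero {A : Set (EuclideanSpace ℝ (Fin d))} (hA : A = ∅ ∨ A = Set.univ) :
    gaussSurf A = 0 := by
  have h0 : rotSensQuot A = fun _ => 0 := by
    ext δ
    have : rotSens A δ = 0 := by
      unfold rotSens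
      rcases hA with rfl | rfl <;> simp
    rw [rotSensQuot, this, ENNReal.zero_div]
  rw [gaussSurf, rotSensDeriv, h0, tendsto_const_nhds.limUnder_eq, mul_zero]

end Congr

/-! ### Surface area of halfspaces by reduction to one dimension -/

section Halfspace

theorem abs_gaussCdf_sub_le (a b : ℝ) : |gaussCdf a - gaussCdf b| ≤ |a - b| := by
  have := Convex.norm_image_sub_le_of_norm_hasDerivWithin_le (C := 1) (s := Set.univ)
    (f := gaussCdf) (f' := gaussianPDFReal 0 1) (x := b) (y := a)
    (fun x _ => (hasDerivAt_gaussCdf x).hasDerivWithinAt) (fun x _ => by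
      rw [Real.norm_of_nonneg (gaussianPDFReal_nonneg 0 1 x)]; exact gaussianPDFReal_le_one x)
    convex_univ (Set.mem_univ _) (Set.mem_univ _)
  simpa using this

theorem lintegral_enorm_indicator_Iic_sub (a b : ℝ) :
    ∫⁻ x, ‖(Set.Iic a).indicator (fun _ => (1 : ℝ)) x - (Set.Iic b).indicator (fun _ => (1 : ℝ)) x‖ₑ
      ∂gaussianReal 0 1 = ENNReal.ofReal |gaussCdf a - gaussCdf b| := by
  wlog hab : b ≤ a generalizing a b
  · rw [abs_sub_comm, ← this b a (by linarith)]
    refine lintegral_congr fun x => ?_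
    rw [← enorm_neg, neg_sub]
  have h1 : ∀ x, ‖(Set.Iic a).indicator (fun _ => (1 : ℝ)) x -
      (Set.Iic b).indicator (fun _ => (1 : ℝ)) x‖ₑ = (Set.Ioc b a).indicator 1 x := by
    classical
    intro x
    simp only [Set.indicator_apply, Set.mem_Iic, Set.mem_Ioc, Pi.one_apply]
    by_cases h2 : x ≤ b
    · simp [h2, h2.trans hab]
    · by_cases h3 : x ≤ a <;> simp [h2, h3, not_le.1 h2]
  simp_rw [h1]
  rw [lintegral_indicator_one measurableSet_Ioc,
    abs_of_nonneg (sub_nonneg.2 (strictMono_gaussCdf.monotone hab)), gaussCdf, gaussCdf,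
    ← StieltjesFunction.measure_Ioc, measure_cdf]

/-- The one-dimensional threshold after a rotation, at distance linear in the angle. -/
theorem abs_sub_rotated_threshold_le {θ : ℝ} (h0 : 0 < θ) (h1 : θ ≤ 1) (τ y : ℝ) :
    |τ - (τ - Real.sin θ * y) / Real.cos θ| ≤ 2 * (|τ| + |y|) * θ := by
  have hc1 := Real.one_sub_sq_div_two_le_cos (x := θ)
  -- This lower bound, valid for θ ≤ 1, is the source of the factor 2.
  have hc : 1 / 2 ≤ Real.cos θ := by nlinarith
  have hcpos : 0 < Real.cos θ := by linarith
  have hs : |Real.sin θ| ≤ θ := (Real.abs_sin_le_abs).trans (abs_of_pos h0).le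
  have e : τ - (τ - Real.sin θ * y) / Real.cos θ =
      (τ * (Real.cos θ - 1) + Real.sin θ * y) / Real.cos θ := by field_simp; ring
  rw [e, abs_div, abs_of_pos hcpos, div_le_iff₀ hcpos]
  have h2 : |τ * (Real.cos θ - 1) + Real.sin θ * y| ≤ |τ| * θ + θ * |y| := by
    refine (abs_add_le _ _).trans ?_
    rw [abs_mul, abs_mul]
    have : |Real.cos θ - 1| ≤ θ := by
      rw [abs_le]; constructor <;> nlinarith [Real.cos_le_one θ]
    gcongr
  have h3 : 0 ≤ (|τ| + |y|) * θ := by positivity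
  nlinarith

theorem tendsto_rotated_threshold (τ y : ℝ) :
    Tendsto (fun θ => ENNReal.ofReal |gaussCdf τ -
      gaussCdf ((τ - Real.sin θ * y) / Real.cos θ)| / ENNReal.ofReal θ) (𝓝[>] 0)
      (𝓝 (ENNReal.ofReal (gaussianPDFReal 0 1 τ) * ‖y‖ₑ)) := by
  have hb : HasDerivAt (fun θ => (τ - Real.sin θ * y) / Real.cos θ) (-y) 0 := by
    refine HasDerivAt.congr_deriv ((((Real.hasDerivAt_sin 0).mul_const y).const_sub τ).div
      (Real.hasDerivAt_cos 0) (by simp)) ?_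
    simp
  have h0 : (τ - Real.sin 0 * y) / Real.cos 0 = τ := by simp
  have hΦ : HasDerivAt gaussCdf (gaussianPDFReal 0 1 τ) ((τ - Real.sin 0 * y) / Real.cos 0) := by
    rw [h0]; exact hasDerivAt_gaussCdf τ
  have hd := hΦ.comp (0 : ℝ) hb
  rw [hasDerivAt_iff_tendsto_slope] at hd
  have hd2 := (hd.mono_left (nhdsWithin_mono 0 fun x (hx : 0 < x) => ne_of_gt hx)).enorm
  rw [enorm_mul, enorm_neg, Real.enorm_of_nonneg (gaussianPDFReal_nonneg 0 1 τ)] at hd2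
  refine hd2.congr' ?_
  filter_upwards [self_mem_nhdsWithin] with θ hθ
  have hθ' : 0 < θ := hθ
  rw [slope_def_field]
  simp only [Function.comp_apply, h0, sub_zero]
  rw [Real.enorm_eq_ofReal_abs, abs_div, abs_of_pos hθ', ENNReal.ofReal_div_of_pos hθ',
    abs_sub_comm]

/-- Dominated convergence: the quotient tends to φ(τ)|y| and is at most 2(|τ| + |y|), because Φ is
1-Lipschitz and the threshold moves by at most that multiple of θ. -/
theorem tendsto_lintegral_rotated_threshold (τ : ℝ) :
    Tendsto (fun θ => (∫⁻ y, ENNReal.ofReal |gaussCdf τ -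
      gaussCdf ((τ - Real.sin θ * y) / Real.cos θ)| ∂gaussianReal 0 1) / ENNReal.ofReal θ) (𝓝[>] 0)
      (𝓝 (ENNReal.ofReal (gaussianPDFReal 0 1 τ) * ENNReal.ofReal √(2 / Real.pi))) := by
  have hcont := continuous_gaussCdf
  have hm : ∀ θ : ℝ, Measurable fun y => ENNReal.ofReal |gaussCdf τ -
      gaussCdf ((τ - Real.sin θ * y) / Real.cos θ)| := fun θ => by
    refine (Continuous.measurable ?_).ennreal_ofReal
    fun_prop
  rw [← lintegral_enorm_gaussianReal, ← lintegral_const_mul _ (by fun_prop)]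
  have hi : Integrable (fun y : ℝ => 2 * (|τ| + |y|)) (gaussianReal 0 1) :=
    ((integrable_const _).add
      (memLp_one_iff_integrable.1 (memLp_id_gaussianReal 1)).abs).const_mul 2
  have := tendsto_lintegral_filter_of_dominated_convergence (μ := gaussianReal 0 1)
    (l := 𝓝[>] (0 : ℝ))
    (F := fun θ y => ENNReal.ofReal |gaussCdf τ -
      gaussCdf ((τ - Real.sin θ * y) / Real.cos θ)| / ENNReal.ofReal θ)
    (f := fun y => ENNReal.ofReal (gaussianPDFReal 0 1 τ) * ‖y‖ₑ)
    (fun y => ENNReal.ofReal (2 * (|τ| + |y|)))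
    (Eventually.of_forall fun θ => (hm θ).div_const _) ?_ ?_
    (Eventually.of_forall fun y => tendsto_rotated_threshold τ y)
  · refine this.congr fun θ => ?_
    simp_rw [ENNReal.div_eq_inv_mul]
    rw [lintegral_const_mul _ (hm θ)]
  · filter_upwards [Ioc_mem_nhdsGT zero_lt_one] with θ hθ
    refine Eventually.of_forall fun y => ?_
    rw [ENNReal.div_le_iff (by simpa using hθ.1) ENNReal.ofReal_ne_top,
      ← ENNReal.ofReal_mul (by positivity)]
    exact ENNReal.ofReal_le_ofReal ((abs_gaussCdf_sub_le _ _).trans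
      (abs_sub_rotated_threshold_le hθ.1 hθ.2 τ y))
  · rw [← ofReal_integral_eq_lintegral_ofReal hi (Eventually.of_forall fun y => by
      simp only [Pi.zero_apply]; positivity)]
    exact ENNReal.ofReal_ne_top

variable {d : ℕ}

theorem measurableSet_halfspace (v : EuclideanSpace ℝ (Fin d)) (t : ℝ) :
    MeasurableSet {x | inner ℝ v x ≤ t} :=
  measurableSet_le (by fun_prop) measurable_const

theorem gaussMeasure_halfspace {v : EuclideanSpace ℝ (Fin d)} (hv : v ≠ 0) (t : ℝ) :
    (gaussMeasure d).real {x | inner ℝ v x ≤ t} = gaussCdf (t / ‖v‖) := by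
  have hpos := norm_pos_iff.2 hv
  have h1 : {x | inner ℝ v x ≤ t} = (fun x => (inner ℝ v x : ℝ)) ⁻¹' Set.Iic t := rfl
  have h2 : (fun x : ℝ => ‖v‖ * x) ⁻¹' Set.Iic t = Set.Iic (t / ‖v‖) := by
    ext x; simp [le_div_iff₀' hpos]
  rw [gaussCdf, cdf_eq_real, Measure.real, Measure.real, h1,
    ← Measure.map_apply (by fun_prop) measurableSet_Iic, map_inner_gaussMeasure_eq_map,
    Measure.map_apply (by fun_prop) measurableSet_Iic, h2]

/-- Only the coordinates along v matter. For a fixed noise coordinate y, the rotated point lies in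
the halfspace exactly when the original coordinate is below a shifted threshold, so disagreement has
the Gaussian mass between two thresholds. Positivity of cos θ keeps the inequality's direction. -/
theorem noiseSens_halfspace {v : EuclideanSpace ℝ (Fin d)} (hv : v ≠ 0) (t : ℝ) {θ : ℝ}
    (hc : 0 < Real.cos θ) :
    noiseSens ({x | inner ℝ v x ≤ t}.indicator fun _ => (1 : ℝ)) θ =
      ∫⁻ y, ENNReal.ofReal |gaussCdf (t / ‖v‖) -
        gaussCdf ((t / ‖v‖ - Real.sin θ * y) / Real.cos θ)| ∂gaussianReal 0 1 := by
  have hpos := norm_pos_iff.2 hv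
  set K : ℝ → ℝ → ℝ≥0∞ := fun a b => ‖(Set.Iic t).indicator (fun _ => (1 : ℝ)) a -
    (Set.Iic t).indicator (fun _ => (1 : ℝ)) (Real.cos θ * a + Real.sin θ * b)‖ₑ with hK
  have hi : Measurable ((Set.Iic t).indicator fun _ => (1 : ℝ)) :=
    measurable_const.indicator measurableSet_Iic
  have hKm : Measurable (Function.uncurry K) := by
    simp only [hK, Function.uncurry_def]; fun_prop
  have hind : ∀ x : EuclideanSpace ℝ (Fin d), {x | inner ℝ v x ≤ t}.indicator (fun _ => (1 : ℝ)) x =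
      (Set.Iic t).indicator (fun _ => (1 : ℝ)) (inner ℝ v x) := fun x => rfl
  have hmap : ∀ H : ℝ → ℝ≥0∞, Measurable H → ∫⁻ x, H (inner ℝ v x) ∂gaussMeasure d =
      ∫⁻ a, H (‖v‖ * a) ∂gaussianReal 0 1 := by
    intro H hH
    rw [← lintegral_map hH (by fun_prop), map_inner_gaussMeasure_eq_map,
      lintegral_map hH (by fun_prop)]
  unfold noiseSens
  simp_rw [hind, inner_add_right, inner_smul_right]
  rw [lintegral_prod_symm _ (by fun_prop)]
  calc ∫⁻ g, ∫⁻ z, K (inner ℝ v z) (inner ℝ v g) ∂gaussMeasure d ∂gaussMeasure d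
      = ∫⁻ g, ∫⁻ a, K (‖v‖ * a) (inner ℝ v g) ∂gaussianReal 0 1 ∂gaussMeasure d :=
        lintegral_congr fun g => hmap (fun a => K a (inner ℝ v g)) (by simp only [hK]; fun_prop)
    _ = ∫⁻ y, ∫⁻ a, K (‖v‖ * a) (‖v‖ * y) ∂gaussianReal 0 1 ∂gaussianReal 0 1 := by
        refine hmap (fun b => ∫⁻ a, K (‖v‖ * a) b ∂gaussianReal 0 1) ?_
        refine Measurable.lintegral_prod_right' (f := fun q : ℝ × ℝ => K (‖v‖ * q.2) q.1) ?_
        simp only [hK]; fun_prop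
    _ = _ := by
        refine lintegral_congr fun y => ?_
        rw [← lintegral_enorm_indicator_Iic_sub]
        refine lintegral_congr fun a => ?_
        classical
        simp only [hK, Set.indicator_apply, Set.mem_Iic]
        have e1 : ‖v‖ * a ≤ t ↔ a ≤ t / ‖v‖ := (le_div_iff₀' hpos).symm
        have e2 : Real.cos θ * (‖v‖ * a) + Real.sin θ * (‖v‖ * y) ≤ t ↔
            a ≤ (t / ‖v‖ - Real.sin θ * y) / Real.cos θ := by
          rw [le_div_iff₀' hc, le_sub_iff_add_le, le_div_iff₀' hpos]
          constructor <;> intro h <;> linarith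
        simp only [e1, e2]

theorem gaussSurf_closed_halfspace {v : EuclideanSpace ℝ (Fin d)} (hv : v ≠ 0) (t : ℝ) :
    gaussSurf {x | inner ℝ v x ≤ t} =
      ENNReal.ofReal (gaussIso ((gaussMeasure d).real {x | inner ℝ v x ≤ t})) := by
  have hq : rotSensQuot {x | inner ℝ v x ≤ t} =ᶠ[𝓝[>] 0] fun θ =>
      (∫⁻ y, ENNReal.ofReal |gaussCdf (t / ‖v‖) -
        gaussCdf ((t / ‖v‖ - Real.sin θ * y) / Real.cos θ)| ∂gaussianReal 0 1) /
        ENNReal.ofReal θ := by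
    filter_upwards [rotSensQuot_eventuallyEq (measurableSet_halfspace v t),
      Ioo_mem_nhdsGT Real.pi_div_two_pos] with θ h1 h2
    rw [h1, noiseSens_halfspace hv t (Real.cos_pos_of_mem_Ioo ⟨by linarith [h2.1, Real.pi_pos], h2.2⟩)]
  have hl := (tendsto_lintegral_rotated_threshold (t / ‖v‖)).congr' hq.symm
  rw [gaussSurf, rotSensDeriv, hl.limUnder_eq, gaussMeasure_halfspace hv, gaussIso_gaussCdf,
    mul_left_comm, ← ENNReal.ofReal_mul (Real.sqrt_nonneg _), ← Real.sqrt_mul (by positivity)]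
  have : Real.pi / 2 * (2 / Real.pi) = 1 := by field_simp
  rw [this]
  simp

/-- The projection on v ≠ 0 is a nondegenerate Gaussian and has no atoms, so the bounding hyperplane
is null. -/
theorem open_halfspace_ae_eq {v : EuclideanSpace ℝ (Fin d)} (hv : v ≠ 0) (t : ℝ) :
    ({x | inner ℝ v x < t} : Set (EuclideanSpace ℝ (Fin d))) =ᵐ[gaussMeasure d]
      {x | inner ℝ v x ≤ t} := by
  have hv' : (‖v‖₊ ^ 2 : NNReal) ≠ 0 := by simpa using hv
  have := nullSingletonClass_gaussianReal (μ := 0) hv'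
  have h1 : (Set.Iio t : Set ℝ) =ᵐ[(gaussMeasure d).map fun w => inner ℝ v w] Set.Iic t := by
    rw [map_inner_gaussMeasure]
    exact Iio_ae_eq_Iic
  exact ae_eq_comp (by fun_prop) h1

theorem gaussSurf_halfspace {H : Set (EuclideanSpace ℝ (Fin d))} (hH : IsHalfspace H) :
    gaussSurf H = ENNReal.ofReal (gaussIso ((gaussMeasure d).real H)) := by
  have hdeg : ∀ {B : Set (EuclideanSpace ℝ (Fin d))}, B = ∅ ∨ B = Set.univ →
      gaussSurf B = ENNReal.ofReal (gaussIso ((gaussMeasure d).real B)) := by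
    intro B hB
    rw [gaussSurf_eq_zero hB]
    rcases hB with rfl | rfl <;> simp [gaussIso]
  obtain ⟨v, t, hv, hH⟩ := hH
  induction t using EReal.rec with
  | bot =>
    rcases hH with rfl | rfl
    · exact hdeg (Or.inl (by ext x; simp))
    · exact hdeg (Or.inl (by ext x; simp))
  | top =>
    rcases hH with rfl | rfl
    · exact hdeg (Or.inr (by ext x; simp))
    · exact hdeg (Or.inr (by ext x; simp [EReal.coe_lt_top]))
  | coe t =>
    simp only [EReal.coe_le_coe_iff, EReal.coe_lt_coe_iff] at hH
    rcases hH with rfl | rfl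
    · exact gaussSurf_closed_halfspace hv t
    · rw [gaussSurf_congr (open_halfspace_ae_eq hv t), gaussSurf_closed_halfspace hv t,
        measureReal_congr (open_halfspace_ae_eq hv t)]

end Halfspace

theorem mainTheorem7 (d : ℕ) (A : Set (EuclideanSpace ℝ (Fin d)))
    (hA : NullMeasurableSet A (gaussMeasure d)) (α : ℝ) (hα : (gaussMeasure d).real A = α) :
    Tendsto (rotSensQuot A) (𝓝[>] (0 : ℝ)) (𝓝 (rotSensDeriv A)) ∧
    ENNReal.ofReal (gaussIso α) ≤ gaussSurf A ∧
    ∀ H : Set (EuclideanSpace ℝ (Fin d)), IsHalfspace H → (gaussMeasure d).real H = α →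
      gaussSurf H ≤ gaussSurf A ∧ gaussSurf H = ENNReal.ofReal (gaussIso α) := by
  -- Volume, sensitivity and surface area ignore null sets, so a measurable representative B may
  -- replace A.
  obtain ⟨B, hB, hAB⟩ := hA
  have h1 : ENNReal.ofReal (gaussIso α) ≤ gaussSurf A := by
    rw [← hα, gaussSurf_congr hAB, measureReal_congr hAB]
    exact gaussIso_le_gaussSurf hB
  refine ⟨?_, h1, fun H hH hHα => ?_⟩
  · rw [rotSensQuot_congr hAB, rotSensDeriv_congr hAB, rotSensDeriv_eq hB]
    exact tendsto_rotSensQuot hB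
  · have h2 : gaussSurf H = ENNReal.ofReal (gaussIso α) := by
      rw [gaussSurf_halfspace hH, hHα]
    exact ⟨h2.trans_le h1, h2⟩
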